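/- Let $V$ be a finite set, and for each $v\in V$ let $\mathcal X_v$ be a finite set with at least two elements. For $S\subseteq V$ write $\mathcal X_S=\prod_{v\in S}\mathcal X_v$ and $X_S=(X_v)_{v\in S}$. Let $G$ be either (a) an undirected graph on $V$; a probability distribution $\mathbb P$ on $\mathcal X_V$ *factorizes on* $G$ if there are a collection $\mathcal C$ of cliques of $G$, maps $\psi_K:\mathcal X_K\to[0,\infty)$ for $K\in\mathcal C$, and a constant $Z>0$ with $\mathbb P(X_V=x)=\frac1Z\prod_{K\in\mathcal C}\psi_K(x_K)$ for all $x$; or (b) an acyclic directed graph on $V$; a probability distribution $\mathbb P$ on $\mathcal X_V$ *factorizes on* $G$ if there are conditional distributions $p_v(\cdot\mid\cdot)$ of $v$ given its parents $\mathrm{pa}(v)$ with $\mathbb P(X_V=x)=\prod_{v\in V}p_v(x_v\mid x_{\mathrm{pa}(v)})$ for all $x$. In case (a), a set $M$ *separates* $X$ and $Y$ if every path (possibly of length $0$) from a vertex of $X$ to a vertex of $Y$ contains a vertex of $M$. In case (b), a trail is a sequence $v_0,\dots,v_k$ ($k\ge 0$) in which consecutive vertices are joined by an arc in either direction; $v_i$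 is a v-structure of it if $0<i<k$ and $(v_{i-1},v_i)$, $(v_{i+1},v_i)$ are arcs; the trail is active given $M$ if no $v_i$ that is not a v-structure lies in $M$ and every v-structure $v_i$ lies in $M$ or has a descendant in $M$; and $M$ *d-separates* $X$ and $Y$ if no trail from a vertex of $X$ to a vertex of $Y$ is active given $M$. Let $B,C,E\subseteq V$ be arbitrary sets of vertices. A *Markov blanket of $B$ in $C$ given $E$* is a set $M\subseteq C\setminus B$ such that for every $N\subseteq C\setminus B$, $$\Big(X_B\perp\!\!\!\perp X_{C\setminus(B\cup N)}\ \big|\ X_{N\cup E}\ \text{ for every distribution on }\mathcal X_V\text{ that factorizes on }G\Big)\iff M\subseteq N .$$ **Theorem.** In both cases the Markov blanket $\mathrm{mb}_C(B\mid E)$ of $B$ in $C$ given $E$ exists and is unique, and $$\mathrm{mb}_C(B\mid E)=\big\{v\in C\setminus B:\ v\text{ is not separated from }B\text{ given }E\cup(C\setminus(B\cup\{v\}))\big\},$$ where "separated" means separated in case (a) and d-separated in case (b). -/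

import Mathlib

open MeasureTheory ProbabilityTheory

/-! ### Separation and d-separation -/

/-- `M` separates `X` and `Y` in the undirected graph `G`: every path (a sequence of vertices,
possibly of length `0` and possibly with repetitions) from a vertex of `X` to a vertex of `Y`
meets `M`. -/
def Separates {V : Type*} (G : SimpleGraph V) (X Y M : Set V) : Prop :=
  ∀ u ∈ X, ∀ v ∈ Y, ∀ p : G.Walk u v, ∃ w ∈ p.support, w ∈ M

/-- A directed graph is acyclic if it has no directed cycle of positive length. -/
def IsAcyclicDigraph {V : Type*} (G : Digraph V) : Prop :=
  ∀ v : V, ¬ Relation.TransGen G.Adj v v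

/-- `p 0, …, p k` is a trail: consecutive vertices are joined by an arc, in either direction. -/
def IsTrail {V : Type*} (G : Digraph V) (k : ℕ) (p : ℕ → V) : Prop :=
  ∀ i < k, G.Adj (p i) (p (i + 1)) ∨ G.Adj (p (i + 1)) (p i)

/-- The vertex `p i` is a v-structure of the trail `p 0, …, p k`. -/
def IsVStructure {V : Type*} (G : Digraph V) (k : ℕ) (p : ℕ → V) (i : ℕ) : Prop :=
  0 < i ∧ i < k ∧ G.Adj (p (i - 1)) (p i) ∧ G.Adj (p (i + 1)) (p i)

/-- The trail `p 0, …, p k` is active given `M`: the vertices that are not v-structures are not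
in `M`, and each v-structure is in `M` or has a descendant in `M`. -/
def IsActiveTrail {V : Type*} (G : Digraph V) (M : Set V) (k : ℕ) (p : ℕ → V) : Prop :=
  IsTrail G k p ∧ ∀ i ≤ k,
    (¬ IsVStructure G k p i → p i ∉ M) ∧
    (IsVStructure G k p i → ∃ w ∈ M, Relation.ReflTransGen G.Adj (p i) w)

/-- `M` d-separates `X` and `Y` in the directed graph `G`. -/
def DSeparates {V : Type*} (G : Digraph V) (X Y M : Set V) : Prop :=
  ∀ (k : ℕ) (p : ℕ → V), p 0 ∈ X → p k ∈ Y → ¬ IsActiveTrail G M k p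

/-! ### Factorization and conditional independence -/

/-- The distribution `μ` on `∏ v, 𝒳 v` factorizes as an undirected graphical model on `G`: its
mass function is, up to normalization, a product of nonnegative functions of `x_S`, for `S` in
a collection of cliques of `G`. -/
def FactorizesUndirected {V : Type*} {𝒳 : V → Type*}
    [∀ v, MeasurableSpace (𝒳 v)] (G : SimpleGraph V) (μ : Measure (∀ v, 𝒳 v)) : Prop :=
  ∃ (𝒞 : Finset (Finset V)) (ψ : ∀ S : Finset V, (∀ v : S, 𝒳 v) → ℝ) (Z : ℝ),
    (∀ S ∈ 𝒞, G.IsClique (S : Set V)) ∧ (∀ S y, 0 ≤ ψ S y) ∧ 0 < Z ∧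
    ∀ x : ∀ v, 𝒳 v, μ.real {x} = 1 / Z * ∏ S ∈ 𝒞, ψ S (S.restrict x)

/-- The set of parents of `v`. -/
def parentSet {V : Type*} (G : Digraph V) (v : V) : Set V := {u | G.Adj u v}

/-- The distribution `μ` on `∏ v, 𝒳 v` factorizes as a directed graphical model on `G`: its mass
function is a product of conditional distributions of the `x_v` given `x_{parents of v}`. -/
def FactorizesDirected {V : Type*} [Fintype V] {𝒳 : V → Type*} [∀ v, Fintype (𝒳 v)]
    [∀ v, MeasurableSpace (𝒳 v)] (G : Digraph V) (μ : Measure (∀ v, 𝒳 v)) : Prop :=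
  ∃ p : ∀ v : V, 𝒳 v → (∀ u : parentSet G v, 𝒳 u) → ℝ,
    (∀ v a y, 0 ≤ p v a y) ∧ (∀ v y, ∑ a, p v a y = 1) ∧
    ∀ x : ∀ v, 𝒳 v, μ.real {x} = ∏ v, p v (x v) ((parentSet G v).domRestrict x)

/-- Under `μ`, the subvectors `X_A` and `X_D` of the coordinate vector `X` are conditionally
independent given the subvector `X_Z`. -/
def CondIndepSubvectors {V : Type*} [Fintype V] {𝒳 : V → Type*} [∀ v, Fintype (𝒳 v)]
    [∀ v, MeasurableSpace (𝒳 v)] [∀ v, DiscreteMeasurableSpace (𝒳 v)]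
    (μ : Measure (∀ v, 𝒳 v)) [IsProbabilityMeasure μ] (A D Z : Set V) : Prop :=
  CondIndepFun (MeasurableSpace.comap (Z.domRestrict (π := 𝒳)) inferInstance)
    (Measurable.comap_le (measurable_pi_lambda _ fun v => measurable_pi_apply v.1))
    (A.domRestrict (π := 𝒳)) (D.domRestrict (π := 𝒳)) μ

/-- `X_A` is independent from `X_D` given `X_Z` for every distribution on `∏ v, 𝒳 v` that
factorizes as an undirected graphical model on `G`. -/
def IndepUndirected {V : Type*} [Fintype V] (𝒳 : V → Type*) [∀ v, Fintype (𝒳 v)]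
    [∀ v, MeasurableSpace (𝒳 v)] [∀ v, DiscreteMeasurableSpace (𝒳 v)]
    (G : SimpleGraph V) (A D Z : Set V) : Prop :=
  ∀ (μ : Measure (∀ v, 𝒳 v)) [IsProbabilityMeasure μ],
    FactorizesUndirected G μ → CondIndepSubvectors μ A D Z

/-- `X_A` is independent from `X_D` given `X_Z` for every distribution on `∏ v, 𝒳 v` that
factorizes as a directed graphical model on `G`. -/
def IndepDirected {V : Type*} [Fintype V] (𝒳 : V → Type*) [∀ v, Fintype (𝒳 v)]
    [∀ v, MeasurableSpace (𝒳 v)] [∀ v, DiscreteMeasurableSpace (𝒳 v)]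
    (G : Digraph V) (A D Z : Set V) : Prop :=
  ∀ (μ : Measure (∀ v, 𝒳 v)) [IsProbabilityMeasure μ],
    FactorizesDirected G μ → CondIndepSubvectors μ A D Z

/-! ### Markov blanket in a set -/

/-- `M` is the Markov blanket of `B` in `C` given `E`, where `Indep A D Z` expresses that `X_A`
is independent from `X_D` given `X_Z` for every distribution of the graphical model: `M` is the
smallest subset of `C \ B` such that `X_B` is independent from `X_{C \ (B ∪ M)}` given
`X_{M ∪ E}`, in the strong sense that a subset `N` of `C \ B` has this property if and only if
it contains `M`. -/
def IsMarkovBlanketIn {V : Type*} (Indep : Set V → Set V → Set V → Prop)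
    (B C E M : Set V) : Prop :=
  M ⊆ C \ B ∧ ∀ N ⊆ C \ B, Indep B (C \ (B ∪ N)) (N ∪ E) ↔ M ⊆ N

/-! The theorem rests on two facts, each proved for undirected and for directed models. (1)
Independence given `Z` in all distributions of the model is the same as (d-)separation by `Z`
(`indepUndirected_iff_separates`, `indepDirected_iff_dSeparates`). (2) `Z` separates `B` from `D`
iff for each `v ∈ D` the set `Z ∪ (D \ {v})` separates `B` from `v`
(`separates_iff_forall_singleton`, `dSeparates_iff_forall_singleton`). For `D = C \ (B ∪ N)` and `Z
= N ∪ E` the set in (2) is `E ∪ (C \ (B ∪ {v}))`, whatever `N` is. So `N` has the independence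
property iff no `v` outside `N` violates a condition that does not mention `N`, that is, iff `N`
contains the claimed blanket (`isMarkovBlanketIn_of_separation`).

Soundness in (1): let `A` be the set of vertices outside `Z` reached from `B`. Each factor lives on
`A ∪ Z` or on `Aᶜ ∪ Z`, so the weight splits as `f * g` and `condIndepSubvectors_of_factor` applies.
In the directed case the vertices that are not ancestors of `B ∪ D ∪ Z` are summed out beforehand
(`sum_mul_prod_conditional`), and `mem_reachable_of_family` takes the place of moralization.

Completeness in (1): a bit is copied along an active path or trail, so its two ends determine each
other. In a directed graph, the neighbours of a v-structure must be made to agree by conditioning on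
`Z`: the v-structure emits a signal if they disagree, and a shortest descent carries it to `Z`,
where silence is observed. The signals must not interfere with the bits. Hence the trail is chosen
of least cost, each v-structure being charged its distance to `Z`; exchange arguments then show that
the trail has no repeated vertex (`vertex_ne`) and that descents avoid its other vertices
(`descent_ne`). Descents may still meet each other, which is harmless as signals are combined by
"or" and never cancel. -/

/-! ### Conditional independence of subvectors as a product formula -/

section CondIndep

variable {V : Type*} {𝒳 : V → Type*}

/-- The set of configurations that agree with `x` on `Z`. -/
def agreeSet (Z : Set V) (x : ∀ v, 𝒳 v) : Set (∀ v, 𝒳 v) := {y | ∀ v ∈ Z, y v = x v}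

/-- A function of configurations depends only on the coordinates in `S`. -/
def DependsOnlyOn {α : Type*} (f : (∀ v, 𝒳 v) → α) (S : Set V) : Prop :=
  ∀ x y, (∀ v ∈ S, x v = y v) → f x = f y

lemma measurable_domRestrict [∀ v, MeasurableSpace (𝒳 v)] (A : Set V) :
    Measurable (A.domRestrict (π := 𝒳)) :=
  measurable_pi_lambda _ fun v => measurable_pi_apply v.1

lemma domRestrict_eq_iff {A : Set V} {x y : ∀ v, 𝒳 v} :
    A.domRestrict x = A.domRestrict y ↔ ∀ v ∈ A, x v = y v := by
  constructor
  · intro h v hv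
    exact congrFun h ⟨v, hv⟩
  · intro h
    funext v
    exact h v.1 v.2

variable [Fintype V] [∀ v, Fintype (𝒳 v)]

/-- A sum weighted by a product of a function of `x_{A ∪ Z}` and a function of `x_{Aᶜ}`
satisfies the product formula of conditional independence given `X_Z`. -/
lemma sum_mul_sum_eq_of_factor [DecidableEq V] {A Z : Set V} {f g : (∀ v, 𝒳 v) → ℝ}
    (hf : DependsOnlyOn f (A ∪ Z)) (hg : DependsOnlyOn g (Aᶜ ∪ Z))
    {φ χ : (∀ v, 𝒳 v) → ℝ} (hφ : DependsOnlyOn φ (A ∪ Z)) (hχ : DependsOnlyOn χ (Aᶜ ∪ Z))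
    (z : ∀ v, 𝒳 v) :
    (∑ x, (agreeSet Z z).indicator (fun x => φ x * χ x * (f x * g x)) x) *
        ∑ x, (agreeSet Z z).indicator (fun x => f x * g x) x =
      (∑ x, (agreeSet Z z).indicator (fun x => φ x * (f x * g x)) x) *
        ∑ x, (agreeSet Z z).indicator (fun x => χ x * (f x * g x)) x := by
  classical
  rw [Finset.sum_mul_sum, Finset.sum_mul_sum, ← Finset.sum_product', ← Finset.sum_product']
  -- Two configurations that agree with `z` on `Z` exchange their coordinates outside `A`. This
  -- involution on pairs matches the terms of the two double sums.
  let mix : (∀ v, 𝒳 v) → (∀ v, 𝒳 v) → ∀ v, 𝒳 v := fun x y v => if v ∈ A then x v else y v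
  have hmix : ∀ x y, mix (mix x y) (mix y x) = x := by
    intro x y
    funext v
    by_cases h : v ∈ A <;> simp [mix, h]
  have hagree : ∀ x y, x ∈ agreeSet Z z → y ∈ agreeSet Z z → mix x y ∈ agreeSet Z z := by
    intro x y hx hy v hv
    by_cases h : v ∈ A <;> simp [mix, h, hx v hv, hy v hv]
  have hleft : ∀ x y, x ∈ agreeSet Z z → y ∈ agreeSet Z z →
      ∀ v ∈ A ∪ Z, mix x y v = x v := by
    intro x y hx hy v hv
    by_cases h : v ∈ A
    · simp [mix, h]
    · have hz := hv.resolve_left h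
      simp [mix, h, hx v hz, hy v hz]
  have hright : ∀ x y, x ∈ agreeSet Z z → y ∈ agreeSet Z z →
      ∀ v ∈ Aᶜ ∪ Z, mix x y v = y v := by
    intro x y hx hy v hv
    by_cases h : v ∈ A
    · have hz := hv.resolve_left (fun h' => h' h)
      simp [mix, h, hx v hz, hy v hz]
    · simp [mix, h]
  refine Finset.sum_nbij' (fun q => (mix q.1 q.2, mix q.2 q.1))
    (fun q => (mix q.1 q.2, mix q.2 q.1)) (by simp) (by simp)
    (fun q _ => by simp [hmix]) (fun q _ => by simp [hmix]) ?_
  rintro ⟨x, y⟩ -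
  dsimp only
  by_cases hx : x ∈ agreeSet Z z
  · by_cases hy : y ∈ agreeSet Z z
    · rw [Set.indicator_of_mem hx, Set.indicator_of_mem hy,
        Set.indicator_of_mem (hagree x y hx hy), Set.indicator_of_mem (hagree y x hy hx),
        hf _ _ (hleft x y hx hy), hf _ _ (hleft y x hy hx), hg _ _ (hright x y hx hy),
        hg _ _ (hright y x hy hx), hφ _ _ (hleft x y hx hy), hχ _ _ (hright y x hy hx)]
      ring
    · have : mix x y ∉ agreeSet Z z ∨ mix y x ∉ agreeSet Z z := by
        by_contra! hcon
        exact hy (hmix y x ▸ hagree _ _ hcon.2 hcon.1)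
      rw [Set.indicator_of_notMem hy, mul_zero]
      rcases this with h | h <;> simp [Set.indicator_of_notMem h]
  · have : mix x y ∉ agreeSet Z z ∨ mix y x ∉ agreeSet Z z := by
      by_contra! hcon
      exact hx (hmix x y ▸ hagree _ _ hcon.1 hcon.2)
    rw [Set.indicator_of_notMem hx, zero_mul]
    rcases this with h | h <;> simp [Set.indicator_of_notMem h]

variable [∀ v, MeasurableSpace (𝒳 v)] [∀ v, DiscreteMeasurableSpace (𝒳 v)]

lemma measurableSet_config (s : Set (∀ v, 𝒳 v)) : MeasurableSet s := s.toFinite.measurableSet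

/-- The conditional expectation is constant on the fibre of `X_Z` through `x`; integrate it over
that fibre. The product form also covers null fibres. -/
lemma condExp_indicator_mul_agreeSet (μ : Measure (∀ v, 𝒳 v)) [IsProbabilityMeasure μ]
    (Z : Set V) (s : Set (∀ v, 𝒳 v)) (x : ∀ v, 𝒳 v) :
    (μ⟦s | MeasurableSpace.comap (Z.domRestrict (π := 𝒳)) inferInstance⟧) x *
      μ.real (agreeSet Z x) = μ.real (s ∩ agreeSet Z x) := by
  have hm := (measurable_domRestrict (𝒳 := 𝒳) Z).comap_le
  set c := μ⟦s | MeasurableSpace.comap (Z.domRestrict (π := 𝒳)) inferInstance⟧ with hc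
  have hcm : Measurable[MeasurableSpace.comap (Z.domRestrict (π := 𝒳)) inferInstance] c :=
    stronglyMeasurable_condExp.measurable
  have hconst : ∀ y ∈ agreeSet Z x, c y = c x := by
    intro y hy
    obtain ⟨t, -, ht⟩ := hcm (measurableSet_singleton (c x))
    have hx : x ∈ c ⁻¹' {c x} := rfl
    rw [← ht] at hx
    have hy' : y ∈ c ⁻¹' {c x} := by
      rw [← ht]
      have : Z.domRestrict y = Z.domRestrict x := domRestrict_eq_iff.2 hy
      simpa [this] using hx
    exact hy'
  have hF : MeasurableSet[MeasurableSpace.comap (Z.domRestrict (π := 𝒳)) inferInstance]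
      (agreeSet Z x) := by
    refine ⟨{Z.domRestrict x}, measurableSet_singleton _, ?_⟩
    ext y
    exact domRestrict_eq_iff
  have hint : Integrable (s.indicator fun _ => (1 : ℝ)) μ :=
    (integrable_const _).indicator (measurableSet_config s)
  have h := setIntegral_condExp hm hint hF
  rw [← hc, setIntegral_congr_fun (measurableSet_config _) hconst,
    setIntegral_const, setIntegral_indicator (measurableSet_config s), setIntegral_const] at h
  simp only [smul_eq_mul, mul_one] at h
  rw [mul_comm, h, Set.inter_comm]

lemma condIndepSubvectors_iff (μ : Measure (∀ v, 𝒳 v)) [IsProbabilityMeasure μ]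
    (A D Z : Set V) :
    CondIndepSubvectors μ A D Z ↔
      ∀ (s : Set (∀ v : A, 𝒳 v)) (t : Set (∀ v : D, 𝒳 v)) (x : ∀ v, 𝒳 v),
        μ.real (A.domRestrict ⁻¹' s ∩ D.domRestrict ⁻¹' t ∩ agreeSet Z x) *
            μ.real (agreeSet Z x) =
          μ.real (A.domRestrict ⁻¹' s ∩ agreeSet Z x) *
            μ.real (D.domRestrict ⁻¹' t ∩ agreeSet Z x) := by
  rw [CondIndepSubvectors, condIndepFun_iff_condExp_inter_preimage_eq_mul
    (measurable_domRestrict A) (measurable_domRestrict D)]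
  constructor
  · intro h s t x
    have h' := h s t s.toFinite.measurableSet t.toFinite.measurableSet
    by_cases h0 : μ.real (agreeSet Z x) = 0
    · have : μ.real (A.domRestrict ⁻¹' s ∩ agreeSet Z x) = 0 :=
        le_antisymm (h0 ▸ measureReal_mono Set.inter_subset_right) measureReal_nonneg
      rw [h0, this]
      simp
    -- The almost sure identity can only be evaluated at atoms, and `x` itself may be null; another
    -- point of the fibre serves as well.
    · have hx : ∃ y ∈ agreeSet Z x, μ {y} ≠ 0 := by
        by_contra! hcon
        apply h0
        rw [Measure.real, (measure_null_iff_singleton (Set.to_countable _)).2 hcon]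
        rfl
      obtain ⟨y, hy, hy0⟩ := hx
      have hxy : agreeSet Z x = agreeSet Z y := by
        ext w
        exact forall₂_congr fun v hv => by rw [hy v hv]
      have e := ae_iff_of_countable.1 h' y hy0
      rw [hxy]
      rw [← condExp_indicator_mul_agreeSet, ← condExp_indicator_mul_agreeSet,
        ← condExp_indicator_mul_agreeSet, e]
      ring
  · intro h s t _ _
    refine ae_iff_of_countable.2 fun x hx => ?_
    have hpos : μ.real (agreeSet Z x) ≠ 0 := by
      have h1 : 0 < μ.real {x} := ENNReal.toReal_pos hx (measure_ne_top _ _)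
      have h2 : μ.real {x} ≤ μ.real (agreeSet Z x) :=
        measureReal_mono (Set.singleton_subset_iff.2 fun v _ => rfl)
      exact (h1.trans_le h2).ne'
    have e := h s t x
    rw [← condExp_indicator_mul_agreeSet, ← condExp_indicator_mul_agreeSet,
      ← condExp_indicator_mul_agreeSet] at e
    have e' := mul_right_cancel₀ hpos (e.trans (by ring :
      _ = (μ⟦A.domRestrict ⁻¹' s | MeasurableSpace.comap (Z.domRestrict (π := 𝒳)) inferInstance⟧) x *
        μ.real (agreeSet Z x) *
        (μ⟦D.domRestrict ⁻¹' t | MeasurableSpace.comap (Z.domRestrict (π := 𝒳)) inferInstance⟧) x *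
          μ.real (agreeSet Z x)))
    refine mul_right_cancel₀ hpos (e'.trans (by ring))

lemma measureReal_eq_sum (μ : Measure (∀ v, 𝒳 v)) [IsProbabilityMeasure μ]
    (s : Set (∀ v, 𝒳 v)) [DecidableEq V] :
    μ.real s = ∑ x, s.indicator (fun y => μ.real {y}) x := by
  classical
  have h := sum_measureReal_singleton (μ := μ) (s.toFinite.toFinset)
  rw [Set.Finite.coe_toFinset] at h
  rw [← h, ← Finset.sum_filter_add_sum_filter_not Finset.univ (· ∈ s)]
  rw [Finset.sum_congr (s₁ := Finset.univ.filter (· ∈ s)) (s₂ := s.toFinite.toFinset)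
    (g := fun y => μ.real {y})]
  · rw [Finset.sum_eq_zero (s := Finset.univ.filter (· ∉ s)), add_zero]
    intro x hx
    exact Set.indicator_of_notMem (by simpa using hx) _
  · ext; simp
  · intro x hx
    exact Set.indicator_of_mem (by simpa using hx) _

/-- The factorization criterion for conditional independence: it suffices that the distribution
agrees on the coordinates in `W` with a weight of the form `f x * g x`. -/
lemma condIndepSubvectors_of_factor [DecidableEq V] (μ : Measure (∀ v, 𝒳 v))
    [IsProbabilityMeasure μ]
    {A B D Z W : Set V} {f g : (∀ v, 𝒳 v) → ℝ}
    (hf : DependsOnlyOn f (A ∪ Z)) (hg : DependsOnlyOn g (Aᶜ ∪ Z))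
    (hB : B ⊆ A ∪ Z) (hD : D ⊆ Aᶜ ∪ Z) (hBW : B ⊆ W) (hDW : D ⊆ W) (hZW : Z ⊆ W)
    (hμ : ∀ F : (∀ v, 𝒳 v) → ℝ, DependsOnlyOn F W →
      ∑ x, F x * μ.real {x} = ∑ x, F x * (f x * g x)) :
    CondIndepSubvectors μ B D Z := by
  classical
  rw [condIndepSubvectors_iff]
  intro s t z
  have key : ∀ S : Set (∀ v, 𝒳 v), DependsOnlyOn (S.indicator fun _ => (1 : ℝ)) W →
      μ.real (S ∩ agreeSet Z z) = ∑ x, (agreeSet Z z).indicator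
        (fun x => S.indicator (fun _ => (1 : ℝ)) x * (f x * g x)) x := by
    intro S hS
    have h := hμ ((S ∩ agreeSet Z z).indicator fun _ => (1 : ℝ)) (by
      intro x y hxy
      have h1 := hS x y hxy
      have h2 : x ∈ agreeSet Z z ↔ y ∈ agreeSet Z z :=
        forall₂_congr fun v hv => by rw [hxy v (hZW hv)]
      by_cases hx : x ∈ agreeSet Z z
      · simp only [Set.indicator_apply, Set.mem_inter_iff, hx, h2.1 hx, and_true] at h1 ⊢
        exact h1
      · have hy : y ∉ agreeSet Z z := fun h => hx (h2.2 h)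
        simp [hx, hy])
    rw [measureReal_eq_sum]
    refine Eq.trans (Finset.sum_congr rfl fun x _ => ?_)
      (h.trans (Finset.sum_congr rfl fun x _ => ?_))
    · simp [Set.indicator_apply]
    · by_cases h1 : x ∈ S <;> by_cases h2 : x ∈ agreeSet Z z <;> simp [h1, h2]
  have hs : ∀ {U : Set V}, B ⊆ U →
      DependsOnlyOn ((B.domRestrict ⁻¹' s).indicator fun _ => (1 : ℝ)) U := by
    intro U hU x y hxy
    have : B.domRestrict x = B.domRestrict y := domRestrict_eq_iff.2 fun v hv => hxy v (hU hv)
    simp [Set.indicator_apply, this]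
  have ht : ∀ {U : Set V}, D ⊆ U →
      DependsOnlyOn ((D.domRestrict ⁻¹' t).indicator fun _ => (1 : ℝ)) U := by
    intro U hU x y hxy
    have : D.domRestrict x = D.domRestrict y := domRestrict_eq_iff.2 fun v hv => hxy v (hU hv)
    simp [Set.indicator_apply, this]
  have hst : ∀ x, (B.domRestrict ⁻¹' s ∩ D.domRestrict ⁻¹' t).indicator (fun _ => (1 : ℝ)) x =
      (B.domRestrict ⁻¹' s).indicator (fun _ => (1 : ℝ)) x *
        (D.domRestrict ⁻¹' t).indicator (fun _ => (1 : ℝ)) x := by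
    intro x
    by_cases h1 : B.domRestrict x ∈ s <;> by_cases h2 : D.domRestrict x ∈ t <;>
      simp [h1, h2]
  have e := sum_mul_sum_eq_of_factor hf hg (hs hB) (ht hD) z
  have e1 := key (B.domRestrict ⁻¹' s ∩ D.domRestrict ⁻¹' t) (by
    intro x y hxy
    rw [hst, hst, hs hBW x y hxy, ht hDW x y hxy])
  have e2 := key Set.univ (by intro x y _; simp)
  simp only [Set.univ_inter, Set.indicator_univ, one_mul] at e2
  simp only [hst] at e1
  rw [e1, e2, key _ (hs hBW), key _ (ht hDW)]
  exact e

/-- A distribution under which, given some value of `X_Z`, the events `X_b = a` and `X_d = c`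
coincide and are neither null nor almost sure, violates conditional independence. -/
lemma not_condIndepSubvectors (μ : Measure (∀ v, 𝒳 v)) [IsProbabilityMeasure μ]
    {B D Z : Set V} {b d : V} (hb : b ∈ B) (hd : d ∈ D) {a : 𝒳 b} {c : 𝒳 d}
    {x₀ x₁ : ∀ v, 𝒳 v} (h₀ : 0 < μ.real {x₀}) (h₁ : 0 < μ.real {x₁})
    (hZ : x₁ ∈ agreeSet Z x₀) (hb₀ : x₀ b ≠ a) (hb₁ : x₁ b = a)
    (H : ∀ x ∈ agreeSet Z x₀, μ.real {x} ≠ 0 → (x b = a ↔ x d = c)) :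
    ¬ CondIndepSubvectors μ B D Z := by
  classical
  rw [condIndepSubvectors_iff]
  intro h
  have e := h {y | y ⟨b, hb⟩ = a} {y | y ⟨d, hd⟩ = c} x₀
  set S := agreeSet Z x₀
  have hs : (B.domRestrict ⁻¹' {y : ∀ v : B, 𝒳 v | y ⟨b, hb⟩ = a} : Set (∀ v, 𝒳 v)) =
      {x | x b = a} := rfl
  have ht : (D.domRestrict ⁻¹' {y : ∀ v : D, 𝒳 v | y ⟨d, hd⟩ = c} : Set (∀ v, 𝒳 v)) =
      {x | x d = c} := rfl
  rw [hs, ht] at e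
  have e1 : μ.real ({x | x b = a} ∩ {x | x d = c} ∩ S) = μ.real ({x | x b = a} ∩ S) := by
    rw [measureReal_eq_sum, measureReal_eq_sum]
    refine Finset.sum_congr rfl fun x _ => ?_
    by_cases hx : x ∈ S ∧ μ.real {x} ≠ 0
    · have := H x hx.1 hx.2
      by_cases hxb : x b = a <;> simp_all
    · by_cases hxS : x ∈ S
      · have : μ.real {x} = 0 := by by_contra hne; exact hx ⟨hxS, hne⟩
        simp [Set.indicator_apply, this]
      · simp [hxS]
  have e2 : μ.real ({x | x d = c} ∩ S) = μ.real ({x | x b = a} ∩ S) := by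
    rw [measureReal_eq_sum, measureReal_eq_sum]
    refine Finset.sum_congr rfl fun x _ => ?_
    by_cases hx : x ∈ S ∧ μ.real {x} ≠ 0
    · have := H x hx.1 hx.2
      by_cases hxb : x b = a <;> simp_all
    · by_cases hxS : x ∈ S
      · have : μ.real {x} = 0 := by by_contra hne; exact hx ⟨hxS, hne⟩
        simp [Set.indicator_apply, this]
      · simp [hxS]
  rw [e1, e2] at e
  have p1 : 0 < μ.real ({x | x b = a} ∩ S) :=
    h₁.trans_le (measureReal_mono (Set.singleton_subset_iff.2 ⟨hb₁, hZ⟩))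
  have p2 : 0 < μ.real ({x | x b = a}ᶜ ∩ S) :=
    h₀.trans_le (measureReal_mono (Set.singleton_subset_iff.2 ⟨hb₀, fun v _ => rfl⟩))
  have p3 : μ.real S = μ.real ({x | x b = a} ∩ S) + μ.real ({x | x b = a}ᶜ ∩ S) := by
    rw [← measureReal_union _ (measurableSet_config _), ← Set.union_inter_distrib_right,
      Set.union_compl_self, Set.univ_inter]
    exact Set.disjoint_left.2 fun x hx hx' => hx'.1 hx.1
  -- With `p` the mass of `X_b = a` in the fibre `S`, the product formula reads `p * μ S = p * p`,
  -- while `μ S` exceeds `p` by at least the mass of `x₀`.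
  have := mul_left_cancel₀ p1.ne' e
  linarith

end CondIndep

/-! ### Markov blankets from a separation criterion -/

section Blanket

variable {V : Type*}

lemma IsMarkovBlanketIn.existsUnique {Indep : Set V → Set V → Set V → Prop} {B C E M : Set V}
    (h : IsMarkovBlanketIn Indep B C E M) : ∃! M : Set V, IsMarkovBlanketIn Indep B C E M := by
  refine ⟨M, h, fun M' h' => Set.Subset.antisymm ?_ ?_⟩
  · exact (h'.2 M h.1).1 ((h.2 M h.1).2 subset_rfl)
  · exact (h.2 M' h'.1).1 ((h'.2 M' h'.1).2 subset_rfl)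

/-- If independence is characterized by a separation relation that satisfies weak union and its
converse for singletons, then the Markov blanket consists of the vertices that are not separated
from `B` given all others. -/
lemma isMarkovBlanketIn_of_separation {Indep Sep : Set V → Set V → Set V → Prop}
    (hsep : ∀ B D Z, Indep B D Z ↔ Sep B D Z)
    (hD : ∀ B D Z, Sep B D Z ↔ ∀ v ∈ D, Sep B {v} (Z ∪ (D \ {v}))) (B C E : Set V) :
    IsMarkovBlanketIn Indep B C E {v ∈ C \ B | ¬ Sep B {v} (E ∪ (C \ (B ∪ {v})))} := by
  refine ⟨fun v hv => hv.1, fun N hN => ?_⟩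
  -- The crux: the conditioning set for a single vertex does not depend on `N`.
  have hset : ∀ v ∈ C \ (B ∪ N),
      N ∪ E ∪ ((C \ (B ∪ N)) \ {v}) = E ∪ (C \ (B ∪ {v})) := by
    intro v hv
    ext w
    have hw := @hN w
    have hvN : w = v → w ∉ N := by rintro rfl h; exact hv.2 (Or.inr h)
    simp only [Set.mem_union, Set.mem_sdiff, Set.mem_singleton_iff] at hw ⊢
    tauto
  rw [hsep, hD]
  constructor
  · intro h v hv
    by_contra hvN
    have hvD : v ∈ C \ (B ∪ N) := ⟨hv.1.1, fun h => h.elim hv.1.2 hvN⟩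
    exact hv.2 (hset v hvD ▸ h v hvD)
  · intro h v hv
    rw [hset v hv]
    by_contra hcon
    exact hv.2 (Or.inr (h ⟨⟨hv.1, fun h => hv.2 (Or.inl h)⟩, hcon⟩))

end Blanket

/-! ### Distributions with prescribed weights -/

lemma exists_measure_of_weights {V : Type*} [Fintype V] {𝒳 : V → Type*} [∀ v, Fintype (𝒳 v)]
    [∀ v, MeasurableSpace (𝒳 v)] [∀ v, DiscreteMeasurableSpace (𝒳 v)] [DecidableEq V]
    (w : (∀ v, 𝒳 v) → ℝ)
    (hw : ∀ x, 0 ≤ w x) (hsum : ∑ x, w x = 1) :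
    ∃ μ : Measure (∀ v, 𝒳 v), IsProbabilityMeasure μ ∧ ∀ x, μ.real {x} = w x := by
  have h1 : ∑ x, ENNReal.ofReal (w x) = 1 := by
    rw [← ENNReal.ofReal_sum_of_nonneg fun x _ => hw x, hsum, ENNReal.ofReal_one]
  refine ⟨(PMF.ofFintype _ h1).toMeasure, inferInstance, fun x => ?_⟩
  rw [Measure.real, PMF.toMeasure_apply_singleton _ _ (measurableSet_singleton x),
    PMF.ofFintype_apply, ENNReal.toReal_ofReal (hw x)]

/-! ### Undirected graphical models -/

section Undirected

variable {V : Type*}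

lemma not_separates_iff {G : SimpleGraph V} {X Y M : Set V} :
    ¬ Separates G X Y M ↔
      ∃ u ∈ X, ∃ v ∈ Y, ∃ p : G.Walk u v, ∀ w ∈ p.support, w ∉ M := by
  simp [Separates]

/-- For the converse, cut a walk that avoids `Z` at its first vertex `v` in `D`: the initial piece
avoids `D \ {v}` as well. -/
lemma separates_iff_forall_singleton (G : SimpleGraph V) (B D Z : Set V) :
    Separates G B D Z ↔ ∀ v ∈ D, Separates G B {v} (Z ∪ (D \ {v})) := by
  constructor
  · rintro h v hv b hb _ rfl p
    obtain ⟨w, hw, hwZ⟩ := h b hb _ hv p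
    exact ⟨w, hw, Or.inl hwZ⟩
  · intro h
    by_contra hcon
    obtain ⟨b, hb, d, hd, p, hp⟩ := not_separates_iff.1 hcon
    have key : ∀ {b d : V} (p : G.Walk b d), d ∈ D → (∀ w ∈ p.support, w ∉ Z) →
        ∃ v ∈ D, ∃ q : G.Walk b v, ∀ w ∈ q.support, w ∉ Z ∪ (D \ {v}) := by
      intro b d p
      induction p with
      | nil =>
        intro hd hp
        refine ⟨_, hd, SimpleGraph.Walk.nil, ?_⟩
        intro w hw
        obtain rfl : w = _ := by simpa using hw
        simpa using hp
      | @cons a c d hac p ih =>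
        intro hd hp
        by_cases ha : a ∈ D
        · refine ⟨a, ha, SimpleGraph.Walk.nil, ?_⟩
          intro w hw
          obtain rfl : w = a := by simpa using hw
          have := hp w (by simp)
          simpa using this
        · obtain ⟨v, hv, q, hq⟩ := ih hd fun w hw => hp w (by simp [hw])
          refine ⟨v, hv, SimpleGraph.Walk.cons hac q, ?_⟩
          intro w hw
          rw [SimpleGraph.Walk.support_cons, List.mem_cons] at hw
          rcases hw with rfl | hw
          · have := hp w (by simp)
            simp [ha, this]
          · exact hq w hw
    obtain ⟨v, hv, q, hq⟩ := key p hd hp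
    obtain ⟨w, hw, hwZ⟩ := h v hv b hb v rfl q
    exact hq w hw hwZ

variable [Fintype V] {𝒳 : V → Type*} [∀ v, Fintype (𝒳 v)]
  [∀ v, MeasurableSpace (𝒳 v)] [∀ v, DiscreteMeasurableSpace (𝒳 v)]

/-- The global Markov property of undirected graphical models. -/
lemma condIndepSubvectors_of_separates {G : SimpleGraph V} {B D Z : Set V}
    (h : Separates G B D Z) (μ : Measure (∀ v, 𝒳 v)) [IsProbabilityMeasure μ]
    (hμ : FactorizesUndirected G μ) : CondIndepSubvectors μ B D Z := by
  classical
  obtain ⟨𝒞, ψ, c, hclique, -, -, hfac⟩ := hμ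
  let A : Set V := {v | ∃ b ∈ B, ∃ p : G.Walk b v, ∀ w ∈ p.support, w ∉ Z}
  -- A clique that meets `A` lies in `A ∪ Z`, since a walk reaching one of its vertices extends by
  -- one edge to any other one outside `Z`.
  have hcl : ∀ S ∈ 𝒞, ¬ (S : Set V) ⊆ A ∪ Z → (S : Set V) ⊆ Aᶜ ∪ Z := by
    intro S hS hSA w hw
    by_contra hwA
    simp only [Set.mem_union, Set.mem_compl_iff, not_or, not_not] at hwA
    obtain ⟨⟨b, hb, p, hp⟩, hwZ⟩ := hwA
    refine hSA fun u hu => ?_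
    by_cases huZ : u ∈ Z
    · exact Or.inr huZ
    left
    by_cases huw : w = u
    · exact huw ▸ ⟨b, hb, p, hp⟩
    · refine ⟨b, hb, p.concat (hclique S hS hw hu huw), ?_⟩
      intro x hx
      rw [SimpleGraph.Walk.support_concat, List.mem_append] at hx
      rcases hx with hx | hx
      · exact hp x hx
      · obtain rfl : x = u := by simpa using hx
        exact huZ
  have hdep : ∀ (S : Finset V) (U : Set V), (S : Set V) ⊆ U →
      DependsOnlyOn (fun x : ∀ v, 𝒳 v => ψ S (S.restrict x)) U := by
    intro S U hSU x y hxy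
    have : S.restrict x = S.restrict y := funext fun v => hxy v (hSU v.2)
    simp only [this]
  refine condIndepSubvectors_of_factor μ (A := A) (W := Set.univ)
    (f := fun x => 1 / c * ∏ S ∈ 𝒞.filter (fun S : Finset V => (S : Set V) ⊆ A ∪ Z),
      ψ S (S.restrict x))
    (g := fun x => ∏ S ∈ 𝒞.filter (fun S : Finset V => ¬ (S : Set V) ⊆ A ∪ Z), ψ S (S.restrict x))
    ?_ ?_ ?_ ?_ (Set.subset_univ _) (Set.subset_univ _) (Set.subset_univ _) ?_
  · intro x y hxy
    dsimp only
    congr 1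
    refine Finset.prod_congr rfl fun S hS => ?_
    exact hdep S _ (Finset.mem_filter.1 hS).2 x y hxy
  · intro x y hxy
    refine Finset.prod_congr rfl fun S hS => ?_
    rw [Finset.mem_filter] at hS
    exact hdep S _ (hcl S hS.1 hS.2) x y hxy
  · intro b hb
    by_cases hbZ : b ∈ Z
    · exact Or.inr hbZ
    · exact Or.inl ⟨b, hb, SimpleGraph.Walk.nil, by simpa using hbZ⟩
  · intro d hd
    left
    rintro ⟨b, hb, p, hp⟩
    obtain ⟨w, hw, hwZ⟩ := h b hb d hd p
    exact hp w hw hwZ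
  · intro F _
    refine Finset.sum_congr rfl fun x _ => ?_
    rw [hfac, mul_assoc (1 / c), Finset.prod_filter_mul_prod_filter_not]

/-- Completeness of separation for undirected graphical models. -/
lemma exists_not_condIndepSubvectors_of_not_separates [∀ v, Nontrivial (𝒳 v)]
    {G : SimpleGraph V} {B D Z : Set V} (h : ¬ Separates G B D Z) :
    ∃ (μ : Measure (∀ v, 𝒳 v)) (_ : IsProbabilityMeasure μ),
      FactorizesUndirected G μ ∧ ¬ CondIndepSubvectors μ B D Z := by
  classical
  obtain ⟨b, hb, d, hd, p, hp⟩ := not_separates_iff.1 h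
  choose o e hoe using fun v => exists_pair_ne (𝒳 v)
  -- The bit `y v = e v` must be the same at all vertices of a clique outside `Z`. In the support it
  -- is therefore constant along walks that avoid `Z`.
  let ok : ∀ S : Finset V, (∀ v : S, 𝒳 v) → Prop := fun S y =>
    ∀ u w : S, (u : V) ∉ Z → (w : V) ∉ Z → (y u = e u ↔ y w = e w)
  let ψ : ∀ S : Finset V, (∀ v : S, 𝒳 v) → ℝ := fun S y => if ok S y then 1 else 0
  let 𝒞 : Finset (Finset V) := Finset.univ.filter fun S => G.IsClique (S : Set V)
  let w : (∀ v, 𝒳 v) → ℝ := fun x => ∏ S ∈ 𝒞, ψ S (S.restrict x)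
  have hψ : ∀ S y, 0 ≤ ψ S y := fun S y => by
    simp only [ψ]; split_ifs <;> simp
  have hw : ∀ x, 0 ≤ w x := fun x => Finset.prod_nonneg fun S _ => hψ _ _
  let x₀ : ∀ v, 𝒳 v := o
  let x₁ : ∀ v, 𝒳 v := fun v => if v ∈ Z then o v else e v
  have h₀ : w x₀ = 1 := Finset.prod_eq_one fun S _ => if_pos fun u v _ _ => by
    simp [x₀, hoe]
  have h₁ : w x₁ = 1 := Finset.prod_eq_one fun S _ => if_pos fun u v hu hv => by
    simp [x₁, hu, hv]
  have hZpos : 0 < ∑ x, w x :=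
    Finset.sum_pos' (fun x _ => hw x) ⟨x₀, Finset.mem_univ _, h₀ ▸ one_pos⟩
  obtain ⟨μ, hμ, hμw⟩ := exists_measure_of_weights (fun x => 1 / (∑ x, w x) * w x)
    (fun x => mul_nonneg (one_div_pos.2 hZpos).le (hw x))
    (by rw [← Finset.mul_sum, one_div, inv_mul_cancel₀ hZpos.ne'])
  refine ⟨μ, hμ, ⟨𝒞, ψ, ∑ x, w x, fun S hS => (Finset.mem_filter.1 hS).2, hψ, hZpos, hμw⟩, ?_⟩
  have hsupp : ∀ x, μ.real {x} ≠ 0 → ∀ u v, G.Adj u v → u ∉ Z → v ∉ Z →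
      (x u = e u ↔ x v = e v) := by
    intro x hx u v huv hu hv
    rw [hμw] at hx
    have hne := Finset.prod_ne_zero_iff.1 (right_ne_zero_of_mul hx) {u, v} (by
      simp only [𝒞, Finset.mem_filter, Finset.mem_univ, true_and, Finset.coe_insert,
        Finset.coe_singleton]
      rw [SimpleGraph.isClique_pair]
      exact fun _ => huv)
    have hok : ok {u, v} (({u, v} : Finset V).restrict x) := by
      by_contra hcon
      exact hne (if_neg hcon)
    exact hok ⟨u, by simp⟩ ⟨v, by simp⟩ hu hv
  refine not_condIndepSubvectors μ hb hd (a := e b) (c := e d) (x₀ := x₀) (x₁ := x₁) ?_ ?_ ?_ ?_ ?_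
    ?_
  · rw [hμw, h₀, mul_one]; exact one_div_pos.2 hZpos
  · rw [hμw, h₁, mul_one]; exact one_div_pos.2 hZpos
  · intro v hv
    simp [x₁, x₀, hv]
  · exact hoe b
  · have : b ∉ Z := hp b (by simp)
    simp [x₁, this]
  · intro x _ hx
    have key : ∀ {b d : V} (p : G.Walk b d), (∀ w ∈ p.support, w ∉ Z) →
        (x b = e b ↔ x d = e d) := by
      intro b d p
      induction p with
      | nil => intro _; rfl
      | @cons a c d hac p ih =>
        intro hp
        exact (hsupp x hx a c hac (hp a (by simp)) (hp c (by simp))).trans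
          (ih fun w hw => hp w (by simp [hw]))
    exact key p hp

lemma indepUndirected_iff_separates [∀ v, Nontrivial (𝒳 v)] (G : SimpleGraph V)
    (B D Z : Set V) : IndepUndirected 𝒳 G B D Z ↔ Separates G B D Z := by
  constructor
  · intro h
    by_contra hcon
    obtain ⟨μ, hμ, hfac, hdep⟩ := exists_not_condIndepSubvectors_of_not_separates (𝒳 := 𝒳) hcon
    exact hdep (h μ hfac)
  · intro h μ _ hμ
    exact condIndepSubvectors_of_separates h μ hμ

end Undirected

/-! ### Active trails as runs of an automaton -/

section ActiveTrails

variable {V : Type*}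

/-- One step of an active trail. The state `(v, true)` means that the trail starts at `v` or has
just arrived there from a child of `v`, and `(v, false)` that it has just arrived from a parent.
Vertices that are not v-structures have to avoid `S`, and v-structures need a descendant
in `T`. -/
inductive TrailStep (G : Digraph V) (S T : Set V) : V × Bool → V × Bool → Prop
  | child {v w : V} (dir : Bool) (hv : v ∉ S) (h : G.Adj v w) : TrailStep G S T (v, dir) (w, false)
  | parent {v w : V} (hv : v ∉ S) (h : G.Adj w v) : TrailStep G S T (v, true) (w, true)
  | collide {v w : V} (hv : ∃ z ∈ T, Relation.ReflTransGen G.Adj v z) (h : G.Adj w v) :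
      TrailStep G S T (v, false) (w, true)

/-- The state `s` can be reached by a trail that starts in `B`. -/
def TrailReach (G : Digraph V) (B S T : Set V) (s : V × Bool) : Prop :=
  ∃ b ∈ B, Relation.ReflTransGen (TrailStep G S T) (b, true) s

variable {G : Digraph V} {B D S T S' T' Z : Set V}

lemma TrailStep.mono (hS : S' ⊆ S) (hT : T ⊆ T') {s t : V × Bool} (h : TrailStep G S T s t) :
    TrailStep G S' T' s t := by
  cases h with
  | child dir hv h => exact .child dir (fun h' => hv (hS h')) h
  | parent hv h => exact .parent (fun h' => hv (hS h')) h
  | collide hv h => exact .collide (hv.imp fun z hz => ⟨hT hz.1, hz.2⟩) h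

lemma TrailReach.mono (hS : S' ⊆ S) (hT : T ⊆ T') {s : V × Bool} (h : TrailReach G B S T s) :
    TrailReach G B S' T' s := by
  obtain ⟨b, hb, h⟩ := h
  exact ⟨b, hb, Relation.ReflTransGen.mono (fun _ _ => TrailStep.mono hS hT) _ _ h⟩

lemma TrailReach.tail {s t : V × Bool} (h : TrailReach G B S T s) (hst : TrailStep G S T s t) :
    TrailReach G B S T t := by
  obtain ⟨b, hb, h⟩ := h
  exact ⟨b, hb, h.tail hst⟩

/-- A trail can be continued along a directed path that avoids `S`. -/
lemma TrailReach.descend {v w : V} {dir : Bool} (h : TrailReach G B S T (v, dir))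
    (hvw : Relation.ReflTransGen G.Adj v w)
    (hS : ∀ u, Relation.ReflTransGen G.Adj v u → u ∉ S) : ∃ dir, TrailReach G B S T (w, dir) := by
  induction hvw with
  | refl => exact ⟨dir, h⟩
  | tail hvx hxy ih =>
    obtain ⟨dir', h'⟩ := ih
    exact ⟨false, h'.tail (.child dir' (hS _ hvx) hxy)⟩

lemma IsAcyclicDigraph.asymm (hG : IsAcyclicDigraph G) {u v : V} (h : G.Adj u v) :
    ¬ G.Adj v u := fun h' => hG u (.tail (.single h) h')

/-- Two vertices are never joined by arcs in both directions, so the direction of arrival and that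
of departure decide whether a vertex is a v-structure. -/
lemma IsActiveTrail.trailReach (hG : IsAcyclicDigraph G) {M : Set V} {k : ℕ} {p : ℕ → V}
    (hp : IsActiveTrail G M k p) (h0 : p 0 ∈ B) :
    p k ∉ M ∧ ∃ dir, TrailReach G B M M (p k, dir) := by
  have key : ∀ i ≤ k, ∃ dir, TrailReach G B M M (p i, dir) ∧
      (dir = false → 0 < i ∧ G.Adj (p (i - 1)) (p i)) ∧
      (dir = true → i = 0 ∨ G.Adj (p i) (p (i - 1))) := by
    intro i
    induction i with
    | zero => exact fun _ => ⟨true, ⟨p 0, h0, .refl⟩, by simp, by simp⟩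
    | succ i ih =>
      intro hi
      obtain ⟨dir, hr, hd, hu⟩ := ih (by omega)
      obtain ⟨hn, hc⟩ := hp.2 i (by omega)
      rcases hp.1 i (by omega) with hadj | hadj
      · refine ⟨false, hr.tail (.child dir (hn fun hv => ?_) hadj), by simpa using hadj, by simp⟩
        exact hG.asymm hadj hv.2.2.2
      · cases dir with
        | true =>
          refine ⟨true, hr.tail (.parent (hn fun hv => ?_) hadj), by simp, by simpa using hadj⟩
          rcases hu rfl with h | h
          · exact absurd h hv.1.ne'
          · exact hG.asymm h hv.2.2.1
        | false =>
          obtain ⟨hpos, hin⟩ := hd rfl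
          exact ⟨true, hr.tail (.collide (hc ⟨hpos, by omega, hin, hadj⟩) hadj), by simp,
            by simpa using hadj⟩
  obtain ⟨dir, hr, -⟩ := key k le_rfl
  exact ⟨(hp.2 k le_rfl).1 fun hv => hv.2.1.false, dir, hr⟩

/-- The sequence grows by one vertex per step. Activity is only claimed at indices `i < k`, because
the status of the last vertex is settled by the next step; at the end it is not a v-structure, and
`hv` applies. -/
lemma TrailReach.exists_isActiveTrail (hG : IsAcyclicDigraph G) {M : Set V} {v : V} {dir : Bool}
    (h : TrailReach G B M M (v, dir)) (hv : v ∉ M) :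
    ∃ k p, p 0 ∈ B ∧ p k = v ∧ IsActiveTrail G M k p := by
  obtain ⟨b, hb, h⟩ := h
  have key : ∀ s, Relation.ReflTransGen (TrailStep G M M) (b, true) s →
      ∃ (k : ℕ) (p : ℕ → V), p 0 ∈ B ∧ p k = s.1 ∧ IsTrail G k p ∧
        (∀ i < k, (¬ IsVStructure G k p i → p i ∉ M) ∧
          (IsVStructure G k p i → ∃ w ∈ M, Relation.ReflTransGen G.Adj (p i) w)) ∧
        (s.2 = false → 0 < k ∧ G.Adj (p (k - 1)) (p k)) ∧
        (s.2 = true → k = 0 ∨ G.Adj (p k) (p (k - 1))) := by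
    intro s hs
    induction hs with
    | refl => exact ⟨0, fun _ => b, hb, rfl, by simp [IsTrail], by simp, by simp, by simp⟩
    | @tail s t _ hst ih =>
      obtain ⟨k, p, h0, hk, htrail, hact, hdown, hup⟩ := ih
      let p' : ℕ → V := fun i => if i ≤ k then p i else t.1
      have hle : ∀ i ≤ k, p' i = p i := fun i hi => if_pos hi
      have hlast : p' (k + 1) = t.1 := if_neg (by omega)
      have hkk : p' k = s.1 := (hle k le_rfl).trans hk
      have hvs : ∀ i < k, (IsVStructure G (k + 1) p' i ↔ IsVStructure G k p i) := by
        intro i hi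
        simp only [IsVStructure, hle i hi.le, hle (i - 1) (by omega), hle (i + 1) (by omega)]
        exact ⟨fun h => ⟨h.1, hi, h.2.2⟩, fun h => ⟨h.1, by omega, h.2.2⟩⟩
      have hvk : IsVStructure G (k + 1) p' k ↔
          0 < k ∧ G.Adj (p (k - 1)) s.1 ∧ G.Adj t.1 s.1 := by
        simp only [IsVStructure, hkk, hlast, hle (k - 1) (by omega)]
        exact ⟨fun h => ⟨h.1, h.2.2⟩, fun h => ⟨h.1, by omega, h.2⟩⟩
      have hadj : G.Adj s.1 t.1 ∨ G.Adj t.1 s.1 := by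
        cases hst with
        | child _ _ h => exact Or.inl h
        | parent _ h => exact Or.inr h
        | collide _ h => exact Or.inr h
      have hmid : (¬ IsVStructure G (k + 1) p' k → s.1 ∉ M) ∧
          (IsVStructure G (k + 1) p' k → ∃ w ∈ M, Relation.ReflTransGen G.Adj s.1 w) := by
        rw [hvk]
        cases hst with
        | child dir hv h => exact ⟨fun _ => hv, fun h' => absurd h'.2.2 (hG.asymm h)⟩
        | parent hv h =>
          refine ⟨fun _ => hv, fun h' => ?_⟩
          rcases hup rfl with h0 | h1
          · exact absurd h0 h'.1.ne'
          · rw [hk] at h1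
            exact absurd h'.2.1 (hG.asymm h1)
        | collide hv h =>
          refine ⟨fun h' => absurd ?_ h', fun _ => hv⟩
          have := hdown rfl
          rw [hk] at this
          exact ⟨this.1, this.2, h⟩
      refine ⟨k + 1, p', by rwa [hle 0 (by omega)], hlast, ?_, ?_, ?_, ?_⟩
      · intro i hi
        rcases Nat.lt_succ_iff_lt_or_eq.1 hi with hi | rfl
        · rw [hle i hi.le, hle (i + 1) hi]
          exact htrail i hi
        · rw [hkk, hlast]
          exact hadj
      · intro i hi
        rcases Nat.lt_succ_iff_lt_or_eq.1 hi with hi | rfl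
        · rw [hvs i hi, hle i hi.le]
          exact hact i hi
        · rw [hkk]
          exact hmid
      · intro ht
        rw [Nat.add_sub_cancel, hlast, hkk]
        cases hst with
        | child _ _ h => exact ⟨Nat.succ_pos k, h⟩
        | parent _ h => simp at ht
        | collide _ h => simp at ht
      · intro ht
        rw [Nat.add_sub_cancel, hlast, hkk]
        cases hst with
        | child _ _ h => simp at ht
        | parent _ h => exact Or.inr h
        | collide _ h => exact Or.inr h
  obtain ⟨k, p, h0, hk, htrail, hact, -, -⟩ := key _ h
  refine ⟨k, p, h0, hk, htrail, fun i hi => ?_⟩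
  rcases hi.lt_or_eq with hi | rfl
  · exact hact i hi
  · exact ⟨fun _ => by rwa [hk], fun hvs => absurd hvs.2.1 (lt_irrefl _)⟩

lemma dSeparates_iff_trailReach (hG : IsAcyclicDigraph G) :
    DSeparates G B D Z ↔ ∀ d ∈ D, d ∉ Z → ∀ dir, ¬ TrailReach G B Z Z (d, dir) := by
  constructor
  · intro h d hd hdZ dir hr
    obtain ⟨k, p, h0, hk, hp⟩ := hr.exists_isActiveTrail hG hdZ
    exact h k p h0 (hk ▸ hd) hp
  · intro h k p h0 hk hp
    obtain ⟨hkZ, dir, hr⟩ := hp.trailReach hG h0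
    exact h _ hk hkZ dir hr

/-- d-separation satisfies weak union, intersection and composition. -/
lemma dSeparates_iff_forall_singleton (hG : IsAcyclicDigraph G) (B D Z : Set V) :
    DSeparates G B D Z ↔ ∀ v ∈ D, DSeparates G B {v} (Z ∪ (D \ {v})) := by
  simp only [dSeparates_iff_trailReach hG]
  constructor
  · rintro h v hv w hw hvZ dir ⟨b, hb, hr⟩
    rw [Set.mem_singleton_iff] at hw
    subst w
    have key : ∀ s, Relation.ReflTransGen (TrailStep G (Z ∪ (D \ {v})) (Z ∪ (D \ {v})))
        (b, true) s → TrailReach G B Z Z s := by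
      intro s hs
      induction hs with
      | refl => exact ⟨b, hb, .refl⟩
      | tail _ hst ih =>
        cases hst with
        | child dir hv h => exact ih.tail (.child dir (fun h' => hv (Or.inl h')) h)
        | parent hv h => exact ih.tail (.parent (fun h' => hv (Or.inl h')) h)
        | @collide u w hu hw =>
          by_cases huZ : ∃ z ∈ Z, Relation.ReflTransGen G.Adj u z
          · exact ih.tail (.collide huZ hw)
          -- This v-structure is opened only by some `z ∈ D`. The descent to `z` avoids `Z`, so
          -- following it gives an active trail from `B` to `D`.
          · obtain ⟨z, hz, huz⟩ := hu
            have hzZ : z ∉ Z := fun h' => huZ ⟨z, h', huz⟩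
            obtain ⟨dir, hr⟩ := ih.descend huz fun u' hu' h' => huZ ⟨u', h', hu'⟩
            exact absurd hr (h z (hz.resolve_left hzZ).1 hzZ dir)
    exact h v hv (fun h' => hvZ (Or.inl h')) dir (key _ hr)
  · rintro h d hd hdZ dir ⟨b, hb, hr⟩
    -- Applied to the first visit to `D`: up to then the trail avoids `D`, hence is active for the
    -- enlarged conditioning set.
    have hno : ∀ v ∈ D, v ∉ Z → ∀ dir, ¬ TrailReach G B (Z ∪ D) Z (v, dir) := by
      intro v hv hvZ dir hr
      refine h v hv v rfl ?_ dir (hr.mono ?_ Set.subset_union_left)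
      · simpa using hvZ
      · exact Set.union_subset_union_right _ Set.sdiff_subset
    have key : ∀ s, Relation.ReflTransGen (TrailStep G Z Z) (b, true) s →
        TrailReach G B (Z ∪ D) Z s := by
      intro s hs
      induction hs with
      | refl => exact ⟨b, hb, .refl⟩
      | tail _ hst ih =>
        cases hst with
        | child dir hv h =>
          exact ih.tail (.child dir (fun h' => h'.elim hv fun h' => hno _ h' hv _ ih) h)
        | parent hv h =>
          exact ih.tail (.parent (fun h' => h'.elim hv fun h' => hno _ h' hv _ ih) h)
        | collide hv h => exact ih.tail (.collide hv h)
    exact hno d hd hdZ dir (key _ hr)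

/-- In the ancestral graph of `B ∪ D ∪ Z`, each vertex and its parents lie on one side of a
d-separation. -/
lemma mem_reachable_of_family (hsep : ∀ d ∈ D, d ∉ Z → ∀ dir, ¬ TrailReach G B Z Z (d, dir))
    {v : V} (hv : ∃ w ∈ B ∪ D ∪ Z, Relation.ReflTransGen G.Adj v w) {u w : V}
    (hu : u = v ∨ G.Adj u v) (hw : w = v ∨ G.Adj w v) (huZ : u ∉ Z)
    (hur : ∃ dir, TrailReach G B Z Z (u, dir)) :
    ∃ dir, TrailReach G B Z Z (w, dir) := by
  have up : ∀ w, v ∉ Z → G.Adj w v → (∃ dir, TrailReach G B Z Z (v, dir)) →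
      ∃ dir, TrailReach G B Z Z (w, dir) := by
    rintro w hvZ hwv ⟨dir, hr⟩
    -- With a descendant in `Z`, the trail may turn at `v` towards `w`. Otherwise `v` has a
    -- descendant `x` in `B` or `D`: if in `B`, start afresh at `x` and climb through `v` to `w`; if
    -- in `D`, descending to `x` contradicts separation.
    by_cases hdesc : ∃ z ∈ Z, Relation.ReflTransGen G.Adj v z
    · cases dir with
      | true => exact ⟨true, hr.tail (.parent hvZ hwv)⟩
      | false => exact ⟨true, hr.tail (.collide hdesc hwv)⟩
    · obtain ⟨x, hx, hvx⟩ := hv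
      have hnZ : ∀ u, Relation.ReflTransGen G.Adj v u → u ∉ Z :=
        fun u hu huZ => hdesc ⟨u, huZ, hu⟩
      rcases hx with (hx | hx) | hx
      · have hback : ∀ y, Relation.ReflTransGen G.Adj y x → Relation.ReflTransGen G.Adj v y →
            TrailReach G B Z Z (y, true) := by
          intro y hyx
          induction hyx using Relation.ReflTransGen.head_induction_on with
          | refl => exact fun _ => ⟨x, hx, .refl⟩
          | head hyc _ ih => exact fun hvy =>
              (ih (hvy.tail hyc)).tail (.parent (hnZ _ (hvy.tail hyc)) hyc)
        exact ⟨true, (hback v hvx .refl).tail (.parent hvZ hwv)⟩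
      · obtain ⟨dir', hr'⟩ := hr.descend hvx hnZ
        exact absurd hr' (hsep x hx (hnZ x hvx) dir')
      · exact absurd ⟨x, hx, hvx⟩ hdesc
  rcases hu with rfl | hu
  · rcases hw with rfl | hw
    · exact hur
    · exact up w huZ hw hur
  · obtain ⟨dir, hr⟩ := hur
    have hrv : TrailReach G B Z Z (v, false) := hr.tail (.child dir huZ hu)
    rcases hw with rfl | hw
    · exact ⟨false, hrv⟩
    · by_cases hvZ : v ∈ Z
      · exact ⟨true, hrv.tail (.collide ⟨v, hvZ, .refl⟩ hw)⟩
      · exact up w hvZ hw ⟨false, hrv⟩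

end ActiveTrails

/-! ### Marginals of directed graphical models -/

section Marginal

variable {V : Type*} {𝒳 : V → Type*}

lemma dependsOnlyOn_conditional {G : Digraph V} {v : V}
    (p : 𝒳 v → (∀ u : parentSet G v, 𝒳 u) → ℝ) :
    DependsOnlyOn (fun x : ∀ v, 𝒳 v => p (x v) ((parentSet G v).domRestrict x))
      ({v} ∪ parentSet G v) := by
  intro x y hxy
  have h1 : x v = y v := hxy v (Or.inl rfl)
  have h2 : (parentSet G v).domRestrict x = (parentSet G v).domRestrict y :=
    domRestrict_eq_iff.2 fun u hu => hxy u (Or.inr hu)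
  simp only [h1, h2]

variable [DecidableEq V] [∀ v, Fintype (𝒳 v)]

lemma sum_conditional_update {G : Digraph V} (hG : IsAcyclicDigraph G) {v : V}
    {p : 𝒳 v → (∀ u : parentSet G v, 𝒳 u) → ℝ} (hp : ∀ y, ∑ a, p a y = 1) (x : ∀ v, 𝒳 v) :
    ∑ a, p (Function.update x v a v)
      ((parentSet G v).domRestrict (Function.update x v a)) = 1 := by
  rw [← hp ((parentSet G v).domRestrict x)]
  refine Finset.sum_congr rfl fun a _ => ?_
  have : (parentSet G v).domRestrict (Function.update x v a) = (parentSet G v).domRestrict x := by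
    refine domRestrict_eq_iff.2 fun u hu => Function.update_of_ne ?_ _ _
    rintro rfl
    exact hG u (.single hu)
  rw [this, Function.update_self]

variable [Fintype V]

/-- The map `(x, a) ↦ (update x s a, x s)` is an involution on pairs. -/
lemma sum_sum_update (s : V) (F : (∀ v, 𝒳 v) → ℝ) :
    ∑ x, ∑ a, F (Function.update x s a) = Fintype.card (𝒳 s) * ∑ x, F x := by
  have h : ∑ y : (∀ v, 𝒳 v), ∑ _c : 𝒳 s, F y = Fintype.card (𝒳 s) * ∑ x, F x := by
    simp [Finset.mul_sum]
  rw [← h, ← Finset.sum_product', ← Finset.sum_product']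
  refine Finset.sum_nbij' (fun q => (Function.update q.1 s q.2, q.1 s))
    (fun q => (Function.update q.1 s q.2, q.1 s)) (by simp) (by simp) ?_ ?_ (by simp)
  · rintro ⟨x, a⟩ -
    simp
  · rintro ⟨x, a⟩ -
    simp

variable [∀ v, Nonempty (𝒳 v)]

/-- Average over the coordinate `s`, which `H` does not see. Replacing `q` by the uniform weight,
instead of deleting the coordinate, keeps all sums over the same configuration space. -/
lemma sum_mul_conditional (s : V) {H q : (∀ v, 𝒳 v) → ℝ}
    (hH : ∀ x a, H (Function.update x s a) = H x)
    (hq : ∀ x, ∑ a, q (Function.update x s a) = 1) :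
    ∑ x, H x * q x = ∑ x, H x * (Fintype.card (𝒳 s) : ℝ)⁻¹ := by
  have hc : (Fintype.card (𝒳 s) : ℝ) ≠ 0 := by simp
  refine mul_left_cancel₀ hc ?_
  rw [← sum_sum_update s, Finset.mul_sum]
  refine Finset.sum_congr rfl fun x _ => ?_
  simp only [hH]
  rw [← Finset.mul_sum, hq]
  field_simp

/-- In a product of conditional distributions, those of the vertices outside an ancestral set `W`
can be replaced by uniform distributions without changing the marginal on `W`. -/
lemma sum_mul_prod_conditional {G : Digraph V} (hG : IsAcyclicDigraph G)
    {q : V → (∀ v, 𝒳 v) → ℝ}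
    (hdep : ∀ v, DependsOnlyOn (q v) ({v} ∪ parentSet G v))
    (hq : ∀ v x, ∑ a, q v (Function.update x v a) = 1)
    {W : Finset V} (hW : ∀ v ∈ W, ∀ u, G.Adj u v → u ∈ W)
    {F : (∀ v, 𝒳 v) → ℝ} (hF : DependsOnlyOn F (W : Set V)) :
    ∑ x, F x * ∏ v, q v x =
      ∑ x, F x * ∏ v, if v ∈ W then q v x else (Fintype.card (𝒳 v) : ℝ)⁻¹ := by
  have hwf : WellFounded (fun a b => Relation.TransGen G.Adj b a) := by
    have : Std.Irrefl (fun a b => Relation.TransGen G.Adj b a) := ⟨hG⟩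
    have : IsTrans V (fun a b => Relation.TransGen G.Adj b a) :=
      ⟨fun a b c hab hbc => hbc.trans hab⟩
    exact Finite.wellFounded_of_trans_of_irrefl _
  have key : ∀ (n : ℕ) (U : Finset V), (U \ W).card = n → W ⊆ U →
      (∀ v ∈ U, ∀ u, G.Adj u v → u ∈ U) →
      ∑ x, F x * ∏ v, (if v ∈ U then q v x else (Fintype.card (𝒳 v) : ℝ)⁻¹) =
        ∑ x, F x * ∏ v, if v ∈ W then q v x else (Fintype.card (𝒳 v) : ℝ)⁻¹ := by
    intro n
    induction n with
    | zero =>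
      intro U hU hWU _
      have : U = W := Finset.Subset.antisymm (Finset.sdiff_eq_empty_iff_subset.1
        (Finset.card_eq_zero.1 hU)) hWU
      rw [this]
    | succ n ih =>
      intro U hU hWU hanc
      -- A minimal `s` has no descendant in `U \ W`. As `W` is ancestral, `s` has no child in `U`,
      -- so `q s` is the only remaining factor that involves `x s`.
      obtain ⟨s, hs, hmin⟩ := hwf.has_min ((U \ W : Finset V) : Set V) (by
        rw [Finset.coe_nonempty, ← Finset.card_pos]
        omega)
      rw [Finset.mem_coe, Finset.mem_sdiff] at hs
      have hchild : ∀ v ∈ U, ¬ G.Adj s v := by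
        intro v hv hadj
        by_cases hvW : v ∈ W
        · exact hs.2 (hW v hvW s hadj)
        · exact hmin v (by simp [hv, hvW]) (.single hadj)
      rw [← ih (U.erase s) ?_ ?_ ?_]
      · have hsplit : ∀ (U' : Finset V) (x : ∀ v, 𝒳 v),
            F x * ∏ v, (if v ∈ U' then q v x else (Fintype.card (𝒳 v) : ℝ)⁻¹) =
              (F x * ∏ v ∈ Finset.univ.erase s,
                if v ∈ U' then q v x else (Fintype.card (𝒳 v) : ℝ)⁻¹) *
              (if s ∈ U' then q s x else (Fintype.card (𝒳 s) : ℝ)⁻¹) := by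
          intro U' x
          rw [mul_assoc, Finset.prod_erase_mul _ _ (Finset.mem_univ s)]
        have herase : ∀ x : ∀ v, 𝒳 v, (∏ v ∈ Finset.univ.erase s,
              if v ∈ U.erase s then q v x else (Fintype.card (𝒳 v) : ℝ)⁻¹) =
            ∏ v ∈ Finset.univ.erase s, if v ∈ U then q v x else (Fintype.card (𝒳 v) : ℝ)⁻¹ := by
          intro x
          refine Finset.prod_congr rfl fun v hv => ?_
          simp [Finset.ne_of_mem_erase hv]
        simp only [hsplit, herase, hs.1, if_true, Finset.notMem_erase, if_false]
        refine sum_mul_conditional s (fun x a => ?_) (hq s)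
        congr 1
        · refine hF _ _ fun v hv => Function.update_of_ne ?_ _ _
          rintro rfl
          exact hs.2 hv
        · refine Finset.prod_congr rfl fun v hv => ?_
          split_ifs with hvU
          · refine hdep v _ _ fun u hu => Function.update_of_ne ?_ _ _
            rintro rfl
            rcases hu with hu | hu
            · exact Finset.ne_of_mem_erase hv hu.symm
            · exact hchild v hvU hu
          · rfl
      · rw [Finset.erase_sdiff_comm, Finset.card_erase_of_mem (Finset.mem_sdiff.2 hs), hU]
        rfl
      · exact fun v hv => Finset.mem_erase.2 ⟨fun h => hs.2 (h ▸ hv), hWU hv⟩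
      · intro v hv u huv
        rw [Finset.mem_erase] at hv ⊢
        exact ⟨fun h => hchild v hv.2 (h ▸ huv), hanc v hv.2 u huv⟩
  simpa using key _ Finset.univ rfl (Finset.subset_univ _) (fun _ _ _ _ => Finset.mem_univ _)

lemma sum_prod_conditional_eq_one {G : Digraph V} (hG : IsAcyclicDigraph G)
    {q : V → (∀ v, 𝒳 v) → ℝ}
    (hdep : ∀ v, DependsOnlyOn (q v) ({v} ∪ parentSet G v))
    (hq : ∀ v x, ∑ a, q v (Function.update x v a) = 1) :
    ∑ x, ∏ v, q v x = 1 := by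
  have h := sum_mul_prod_conditional hG hdep hq (W := ∅) (F := fun _ => 1) (by simp)
    (fun _ _ _ => rfl)
  simp only [one_mul, Finset.notMem_empty, if_false] at h
  rw [h, Finset.sum_const, Finset.card_univ, Fintype.card_pi, nsmul_eq_mul, Nat.cast_prod,
    ← Finset.prod_mul_distrib]
  exact Finset.prod_eq_one fun v _ => mul_inv_cancel₀ (by simp)

end Marginal

/-! ### Directed graphical models: global Markov property and distributions with prescribed support
-/

section Directed

variable {V : Type*} [Fintype V] {𝒳 : V → Type*} [∀ v, Fintype (𝒳 v)] [∀ v, Nonempty (𝒳 v)]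
  [∀ v, MeasurableSpace (𝒳 v)] [∀ v, DiscreteMeasurableSpace (𝒳 v)]

/-- The global Markov property of directed graphical models. -/
lemma condIndepSubvectors_of_dSeparates {G : Digraph V} (hG : IsAcyclicDigraph G)
    {B D Z : Set V} (h : DSeparates G B D Z) (μ : Measure (∀ v, 𝒳 v)) [IsProbabilityMeasure μ]
    (hμ : FactorizesDirected G μ) : CondIndepSubvectors μ B D Z := by
  classical
  rw [dSeparates_iff_trailReach hG] at h
  obtain ⟨p, -, hsum, hfac⟩ := hμ
  let q : V → (∀ v, 𝒳 v) → ℝ := fun v x => p v (x v) ((parentSet G v).domRestrict x)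
  have hdep : ∀ v, DependsOnlyOn (q v) ({v} ∪ parentSet G v) :=
    fun v => dependsOnlyOn_conditional (p v)
  have hq : ∀ v x, ∑ a, q v (Function.update x v a) = 1 :=
    fun v x => sum_conditional_update hG (hsum v) x
  let W : Finset V := Finset.univ.filter fun v =>
    ∃ w ∈ B ∪ D ∪ Z, Relation.ReflTransGen G.Adj v w
  have hmemW : ∀ v, v ∈ W ↔ ∃ w ∈ B ∪ D ∪ Z, Relation.ReflTransGen G.Adj v w := fun v => by
    simp [W]
  have hsubW : B ∪ D ∪ Z ⊆ (W : Set V) := fun v hv => (hmemW v).2 ⟨v, hv, .refl⟩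
  have hW : ∀ v ∈ W, ∀ u, G.Adj u v → u ∈ W := by
    intro v hv u huv
    obtain ⟨w, hw, hvw⟩ := (hmemW v).1 hv
    exact (hmemW u).2 ⟨w, hw, hvw.head huv⟩
  -- `Z` is excluded explicitly, because a run may arrive at a vertex of `Z`, for instance to turn
  -- there.
  let A : Set V := {v | v ∉ Z ∧ ∃ dir, TrailReach G B Z Z (v, dir)}
  have hfam : ∀ v ∈ W, ¬ ({v} ∪ parentSet G v ⊆ A ∪ Z) → {v} ∪ parentSet G v ⊆ Aᶜ ∪ Z := by
    intro v hv hnot u hu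
    by_contra hcon
    simp only [Set.mem_union, Set.mem_compl_iff, not_or, not_not] at hcon
    refine hnot fun w hw => ?_
    by_cases hwZ : w ∈ Z
    · exact Or.inr hwZ
    · exact Or.inl ⟨hwZ, mem_reachable_of_family h ((hmemW v).1 hv) hu hw hcon.2 hcon.1.2⟩
  refine condIndepSubvectors_of_factor μ (A := A) (W := (W : Set V))
    (f := fun x => ∏ v with {v} ∪ parentSet G v ⊆ A ∪ Z,
      if v ∈ W then q v x else (Fintype.card (𝒳 v) : ℝ)⁻¹)
    (g := fun x => ∏ v with ¬ ({v} ∪ parentSet G v ⊆ A ∪ Z),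
      if v ∈ W then q v x else (Fintype.card (𝒳 v) : ℝ)⁻¹)
    ?_ ?_ ?_ ?_ ?_ ?_ ?_ ?_
  · intro x y hxy
    refine Finset.prod_congr rfl fun v hv => ?_
    rw [hdep v x y fun u hu => hxy u ((Finset.mem_filter.1 hv).2 hu)]
  · intro x y hxy
    refine Finset.prod_congr rfl fun v hv => ?_
    by_cases hvW : v ∈ W
    · rw [hdep v x y fun u hu => hxy u (hfam v hvW (Finset.mem_filter.1 hv).2 hu)]
    · rw [if_neg hvW, if_neg hvW]
  · intro b hb
    by_cases hbZ : b ∈ Z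
    · exact Or.inr hbZ
    · exact Or.inl ⟨hbZ, true, b, hb, .refl⟩
  · intro d hd
    left
    rintro ⟨hdZ, dir, hr⟩
    exact h d hd hdZ dir hr
  · exact fun v hv => hsubW (Or.inl (Or.inl hv))
  · exact fun v hv => hsubW (Or.inl (Or.inr hv))
  · exact fun v hv => hsubW (Or.inr hv)
  · intro F hF
    simp only [Finset.prod_filter_mul_prod_filter_not, hfac]
    exact sum_mul_prod_conditional hG hdep hq hW hF

/-- There is a distribution that factorizes on `G` and whose support is described by nonempty
sets of admissible values of each vertex that depend on the values of its parents. -/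
lemma exists_factorizesDirected_of_support {G : Digraph V} (hG : IsAcyclicDigraph G)
    (allowed : ∀ v, (∀ v, 𝒳 v) → Set (𝒳 v))
    (hdep : ∀ v, DependsOnlyOn (allowed v) (parentSet G v))
    (hne : ∀ v x, (allowed v x).Nonempty) :
    ∃ (μ : Measure (∀ v, 𝒳 v)) (_ : IsProbabilityMeasure μ), FactorizesDirected G μ ∧
      ∀ x, μ.real {x} ≠ 0 ↔ ∀ v, x v ∈ allowed v x := by
  classical
  let x₀ : ∀ v, 𝒳 v := fun v => Classical.arbitrary _
  -- `allowed v` takes a full configuration; the values filled in off the parents are irrelevant by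
  -- `hdep`. The conditional distributions are then uniform on the admissible values.
  let ext : ∀ v, (∀ u : parentSet G v, 𝒳 u) → ∀ v, 𝒳 v := fun v y u =>
    if h : u ∈ parentSet G v then y ⟨u, h⟩ else x₀ u
  have hext : ∀ v x, allowed v (ext v ((parentSet G v).domRestrict x)) = allowed v x := by
    intro v x
    refine hdep v _ _ fun u hu => ?_
    simp [ext, hu]
  let p : ∀ v : V, 𝒳 v → (∀ u : parentSet G v, 𝒳 u) → ℝ := fun v a y =>
    if a ∈ allowed v (ext v y) then
      ((Finset.univ.filter fun a => a ∈ allowed v (ext v y)).card : ℝ)⁻¹ else 0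
  have hcard : ∀ v y, 0 < ((Finset.univ.filter fun a => a ∈ allowed v (ext v y)).card : ℝ) := by
    intro v y
    obtain ⟨a, ha⟩ := hne v (ext v y)
    exact Nat.cast_pos.2 (Finset.card_pos.2 ⟨a, by simpa using ha⟩)
  have hp0 : ∀ v a y, 0 ≤ p v a y := by
    intro v a y
    simp only [p]
    split_ifs
    · exact (inv_pos.2 (hcard v y)).le
    · exact le_rfl
  have hp1 : ∀ v y, ∑ a, p v a y = 1 := by
    intro v y
    simp only [p]
    rw [← Finset.sum_filter, Finset.sum_const, nsmul_eq_mul, mul_inv_cancel₀ (hcard v y).ne']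
  obtain ⟨μ, hμ, hμw⟩ := exists_measure_of_weights
    (fun x => ∏ v, p v (x v) ((parentSet G v).domRestrict x))
    (fun x => Finset.prod_nonneg fun v _ => hp0 _ _ _)
    (sum_prod_conditional_eq_one hG (fun v => dependsOnlyOn_conditional (p v))
      fun v x => sum_conditional_update hG (hp1 v) x)
  refine ⟨μ, hμ, ⟨p, hp0, hp1, hμw⟩, fun x => ?_⟩
  rw [hμw, Finset.prod_ne_zero_iff]
  refine forall_congr' fun v => ?_
  rw [← hext v x]
  simp only [Finset.mem_univ, true_imp_iff, p]
  constructor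
  · intro h
    by_contra hcon
    exact h (if_neg hcon)
  · intro h
    rw [if_pos h]
    exact (inv_pos.2 (hcard v _)).ne'

end Directed

/-! ### Cheapest active trails -/

section CheapestTrail

variable {V : Type*} {G : Digraph V} {D Z : Set V}

/-- There is a directed walk of length `n` from `v` to a vertex of `Z`. -/
inductive DescentTo (G : Digraph V) (Z : Set V) : V → ℕ → Prop
  | zero {v : V} (h : v ∈ Z) : DescentTo G Z v 0
  | succ {v w : V} {n : ℕ} (h : G.Adj v w) (hw : DescentTo G Z w n) : DescentTo G Z v (n + 1)

/-- The length of a shortest directed walk from `v` to `Z`. -/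
noncomputable def descentDist (G : Digraph V) (Z : Set V) (v : V) : ℕ :=
  sInf {n | DescentTo G Z v n}

lemma exists_descentTo_iff {v : V} :
    (∃ n, DescentTo G Z v n) ↔ ∃ z ∈ Z, Relation.ReflTransGen G.Adj v z := by
  constructor
  · rintro ⟨n, h⟩
    induction h with
    | zero h => exact ⟨_, h, .refl⟩
    | succ h _ ih =>
      obtain ⟨z, hz, hwz⟩ := ih
      exact ⟨z, hz, hwz.head h⟩
  · rintro ⟨z, hz, h⟩
    induction h using Relation.ReflTransGen.head_induction_on with
    | refl => exact ⟨0, .zero hz⟩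
    | head h _ ih =>
      obtain ⟨n, hn⟩ := ih
      exact ⟨n + 1, .succ h hn⟩

/-- The existence of a descent from `w` is needed, since `descentDist` has the default value `0`
where there is none. -/
lemma descentDist_le_succ {v w : V} (h : G.Adj v w) (hw : ∃ n, DescentTo G Z w n) :
    descentDist G Z v ≤ descentDist G Z w + 1 :=
  Nat.sInf_le (DescentTo.succ h (Nat.sInf_mem hw))

lemma descentDist_eq_zero {v : V} (hv : v ∈ Z) : descentDist G Z v = 0 :=
  Nat.le_zero.1 (Nat.sInf_le (DescentTo.zero hv))

/-- `w` is the next vertex after `v` on a shortest directed walk to `Z`. -/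
def ShortestDescent (G : Digraph V) (Z : Set V) (v w : V) : Prop :=
  G.Adj v w ∧ (∃ n, DescentTo G Z w n) ∧ descentDist G Z v = descentDist G Z w + 1

lemma ShortestDescent.notMem {v w : V} (h : ShortestDescent G Z v w) : v ∉ Z := by
  intro hv
  have := descentDist_eq_zero (G := G) hv
  rw [h.2.2] at this
  omega

lemma exists_shortestDescent {v : V} (hv : ∃ n, DescentTo G Z v n) (hvZ : v ∉ Z) :
    ∃ w, ShortestDescent G Z v w := by
  have h : DescentTo G Z v (descentDist G Z v) := Nat.sInf_mem hv
  generalize hn : descentDist G Z v = m at h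
  cases h with
  | zero h => exact absurd h hvZ
  | @succ _ w n h hw =>
    refine ⟨w, h, ⟨n, hw⟩, ?_⟩
    have h1 := descentDist_le_succ h ⟨n, hw⟩
    have h2 : descentDist G Z w ≤ n := Nat.sInf_le hw
    omega

lemma exists_reflTransGen_shortestDescent {v : V} (hv : ∃ n, DescentTo G Z v n) :
    ∃ z ∈ Z, Relation.ReflTransGen (ShortestDescent G Z) v z := by
  induction hn : descentDist G Z v generalizing v with
  | zero =>
    by_cases hvZ : v ∈ Z
    · exact ⟨v, hvZ, .refl⟩
    · obtain ⟨w, hw⟩ := exists_shortestDescent hv hvZ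
      have := hw.2.2
      omega
  | succ n ih =>
    by_cases hvZ : v ∈ Z
    · exact ⟨v, hvZ, .refl⟩
    · obtain ⟨w, hw⟩ := exists_shortestDescent hv hvZ
      obtain ⟨z, hz, hwz⟩ := ih hw.2.1 (by have := hw.2.2; omega)
      exact ⟨z, hz, hwz.head hw⟩

lemma exists_descentTo_of_reflTransGen {v w : V} (hv : ∃ n, DescentTo G Z v n)
    (h : Relation.ReflTransGen (ShortestDescent G Z) v w) : ∃ n, DescentTo G Z w n := by
  cases h with
  | refl => exact hv
  | tail _ h => exact h.2.1

/-- The cost of a step of a trail: v-structures are charged for their distance to `Z`. -/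
noncomputable def stepCost (G : Digraph V) (Z : Set V) (s t : V × Bool) : ℕ :=
  if s.2 = false ∧ t.2 = true then descentDist G Z s.1 + 1 else 1

/-- An active trail in state `s` can be completed to one that ends in `D`, with cost `n`. -/
inductive CompletesIn (G : Digraph V) (D Z : Set V) : V × Bool → ℕ → Prop
  | done {s : V × Bool} (hD : s.1 ∈ D) (hZ : s.1 ∉ Z) : CompletesIn G D Z s 0
  | step {s t : V × Bool} {n : ℕ} (h : TrailStep G Z Z s t) (ht : CompletesIn G D Z t n) :
      CompletesIn G D Z s (n + stepCost G Z s t)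

/-- The least cost of completing an active trail. -/
noncomputable def costToGo (G : Digraph V) (D Z : Set V) (s : V × Bool) : ℕ :=
  sInf {n | CompletesIn G D Z s n}

/-- An active trail in state `s` can be completed to one that ends in `D`. -/
def Completable (G : Digraph V) (D Z : Set V) (s : V × Bool) : Prop :=
  ∃ n, CompletesIn G D Z s n

lemma Completable.step {s t : V × Bool} (ht : Completable G D Z t) (h : TrailStep G Z Z s t) :
    Completable G D Z s ∧ costToGo G D Z s ≤ costToGo G D Z t + stepCost G Z s t := by
  have h' := CompletesIn.step h (Nat.sInf_mem ht)
  exact ⟨⟨_, h'⟩, Nat.sInf_le h'⟩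

lemma completable_of_mem {s : V × Bool} (hD : s.1 ∈ D) (hZ : s.1 ∉ Z) :
    Completable G D Z s ∧ costToGo G D Z s = 0 :=
  ⟨⟨0, .done hD hZ⟩, Nat.le_zero.1 (Nat.sInf_le (CompletesIn.done hD hZ))⟩

lemma Completable.cases {s : V × Bool} (hs : Completable G D Z s) :
    (s.1 ∈ D ∧ s.1 ∉ Z) ∨ ∃ t, TrailStep G Z Z s t ∧ Completable G D Z t ∧
      costToGo G D Z s = costToGo G D Z t + stepCost G Z s t := by
  have h : CompletesIn G D Z s (costToGo G D Z s) := Nat.sInf_mem hs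
  generalize hn : costToGo G D Z s = m at h
  cases h with
  | done hD hZ => exact Or.inl ⟨hD, hZ⟩
  | @step _ t n h ht =>
    refine Or.inr ⟨t, h, ⟨n, ht⟩, ?_⟩
    have h1 := (Completable.step ⟨n, ht⟩ h).2
    have h2 : costToGo G D Z t ≤ n := Nat.sInf_le ht
    omega

/-- The same next move is available from `(v, true)`, and turning upwards there costs `1` instead of
the v-structure charge. -/
lemma Completable.up {v : V} (hv : v ∉ Z) (h : Completable G D Z (v, false)) :
    Completable G D Z (v, true) ∧ costToGo G D Z (v, true) ≤ costToGo G D Z (v, false) := by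
  rcases h.cases with ⟨hD, hZ⟩ | ⟨t, hst, ht, he⟩
  · have h1 := completable_of_mem (G := G) (s := (v, true)) hD hZ
    exact ⟨h1.1, by omega⟩
  · cases hst with
    | child _ _ hadj =>
      have h1 := ht.step (s := (v, true)) (.child true hv hadj)
      refine ⟨h1.1, ?_⟩
      simp only [stepCost] at h1 he
      simp at h1 he
      omega
    | collide _ hadj =>
      have h1 := ht.step (s := (v, true)) (.parent hv hadj)
      refine ⟨h1.1, ?_⟩
      simp only [stepCost] at h1 he
      simp at h1 he
      omega

/-- The same next move is available from `(v, false)`; only going up becomes dearer, by the distance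
from `v` to `Z`. -/
lemma Completable.down {v : V} (hv : ∃ n, DescentTo G Z v n) (h : Completable G D Z (v, true)) :
    Completable G D Z (v, false) ∧
      costToGo G D Z (v, false) ≤ descentDist G Z v + costToGo G D Z (v, true) := by
  rcases h.cases with ⟨hD, hZ⟩ | ⟨t, hst, ht, he⟩
  · have h1 := completable_of_mem (G := G) (s := (v, false)) hD hZ
    exact ⟨h1.1, by omega⟩
  · cases hst with
    | child _ hvZ hadj =>
      have h1 := ht.step (s := (v, false)) (.child false hvZ hadj)
      refine ⟨h1.1, ?_⟩
      simp only [stepCost] at h1 he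
      simp at h1 he
      omega
    | parent hvZ hadj =>
      have h1 := ht.step (s := (v, false)) (.collide (exists_descentTo_iff.1 hv) hadj)
      refine ⟨h1.1, ?_⟩
      simp only [stepCost] at h1 he
      simp at h1 he
      omega

/-- Each step down a shortest descent costs `1` and lowers the distance to `Z` by `1`; its starting
point is outside `Z`, so it may be passed. -/
lemma Completable.of_descent {v w : V}
    (hvw : Relation.ReflTransGen (ShortestDescent G Z) v w)
    (h : Completable G D Z (w, false)) :
    Completable G D Z (v, false) ∧
      costToGo G D Z (v, false) + descentDist G Z w ≤
        costToGo G D Z (w, false) + descentDist G Z v := by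
  induction hvw using Relation.ReflTransGen.head_induction_on with
  | refl => exact ⟨h, le_rfl⟩
  | @head a c hac _ ih =>
    have h1 := ih.1.step (s := (a, false)) (.child false hac.notMem hac.1)
    refine ⟨h1.1, ?_⟩
    have h2 := hac.2.2
    simp only [stepCost] at h1
    simp at h1
    omega

/-- The same descent climbed from `w` to `v`, again at cost `1` per step. Only `w` could lie in `Z`,
whence `hw`. -/
lemma Completable.of_ascent {v w : V} (hw : w ∉ Z)
    (hvw : Relation.ReflTransGen (ShortestDescent G Z) v w)
    (h : Completable G D Z (v, true)) :
    Completable G D Z (w, true) ∧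
      costToGo G D Z (w, true) + descentDist G Z w ≤
        costToGo G D Z (v, true) + descentDist G Z v := by
  induction hvw with
  | refl => exact ⟨h, le_rfl⟩
  | @tail a c _ hac ih =>
    obtain ⟨h1, h2⟩ := ih hac.notMem
    have h3 := h1.step (s := (c, true)) (.parent hw hac.1)
    refine ⟨h3.1, ?_⟩
    have h4 := hac.2.2
    simp only [stepCost] at h3
    simp at h3
    omega

/-- `f 0, …, f k` are the states of an active trail that ends in `D` and cannot be completed at
a smaller cost from any of them. -/
structure IsCheapestTrail (G : Digraph V) (D Z : Set V) (k : ℕ) (f : ℕ → V × Bool) : Prop where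
  step : ∀ i < k, TrailStep G Z Z (f i) (f (i + 1))
  cost : ∀ i < k, costToGo G D Z (f i) = costToGo G D Z (f (i + 1)) + stepCost G Z (f i) (f (i + 1))
  completable : ∀ i ≤ k, Completable G D Z (f i)
  last_mem : (f k).1 ∈ D
  last_notMem : (f k).1 ∉ Z

lemma one_le_stepCost (s t : V × Bool) : 1 ≤ stepCost G Z s t := by
  unfold stepCost
  split_ifs <;> omega

lemma Completable.exists_isCheapestTrail {s : V × Bool} (hs : Completable G D Z s) :
    ∃ k f, f 0 = s ∧ IsCheapestTrail G D Z k f := by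
  induction hn : costToGo G D Z s using Nat.strong_induction_on generalizing s with
  | _ n ih =>
    rcases hs.cases with ⟨hD, hZ⟩ | ⟨t, hst, ht, he⟩
    · exact ⟨0, fun _ => s, rfl, by simp, by simp, fun _ _ => hs, hD, hZ⟩
    · have h1 := one_le_stepCost (G := G) (Z := Z) s t
      obtain ⟨k, f, h0, hf⟩ := ih (costToGo G D Z t) (by omega) ht rfl
      refine ⟨k + 1, fun i => Nat.casesOn i s f, rfl, ?_, ?_, ?_, hf.last_mem, hf.last_notMem⟩
      · rintro (_ | i) hi
        · simpa [h0] using hst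
        · exact hf.step i (by omega)
      · rintro (_ | i) hi
        · simpa [h0] using he
        · exact hf.cost i (by omega)
      · rintro (_ | i) hi
        · exact hs
        · exact hf.completable i (by omega)

/-- The `i`-th vertex of a trail of states is a v-structure. -/
def IsColliderAt (k : ℕ) (f : ℕ → V × Bool) (i : ℕ) : Prop :=
  i < k ∧ (f i).2 = false ∧ (f (i + 1)).2 = true

namespace IsCheapestTrail

variable {k : ℕ} {f : ℕ → V × Bool}

lemma costToGo_le (hf : IsCheapestTrail G D Z k f) {i j : ℕ} (hij : i ≤ j) (hj : j ≤ k) :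
    costToGo G D Z (f j) ≤ costToGo G D Z (f i) := by
  induction j, hij using Nat.le_induction with
  | base => exact le_rfl
  | succ j hij ih =>
    have := hf.cost j (by omega)
    have := ih (by omega)
    omega

lemma costToGo_lt (hf : IsCheapestTrail G D Z k f) {i j : ℕ} (hij : i < j) (hj : j ≤ k) :
    costToGo G D Z (f j) < costToGo G D Z (f i) := by
  have h1 := hf.costToGo_le (i := i + 1) hij hj
  have h2 := hf.cost i (by omega)
  have h3 := one_le_stepCost (G := G) (Z := Z) (f i) (f (i + 1))
  omega

lemma notMem (hf : IsCheapestTrail G D Z k f)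
    {i : ℕ} (hi : i ≤ k) (hc : ¬ IsColliderAt k f i) : (f i).1 ∉ Z := by
  rcases hi.lt_or_eq with hi | rfl
  · have h := hf.step i hi
    unfold IsColliderAt at hc
    generalize f i = s at *
    generalize f (i + 1) = t at *
    cases h with
    | child _ hv _ => exact hv
    | parent hv _ => exact hv
    | collide _ _ => exact absurd ⟨hi, rfl, rfl⟩ hc
  · exact hf.last_notMem

lemma adj_of_down (hf : IsCheapestTrail G D Z k f)
    {i : ℕ} (hi : i < k) (h : (f (i + 1)).2 = false) :
    G.Adj (f i).1 (f (i + 1)).1 := by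
  have hs := hf.step i hi
  generalize f i = s at *
  generalize f (i + 1) = t at *
  cases hs with
  | child _ _ hadj => exact hadj
  | parent _ _ => simp at h
  | collide _ _ => simp at h

lemma adj_of_up (hf : IsCheapestTrail G D Z k f) {i : ℕ} (hi : i < k) (h : (f (i + 1)).2 = true) :
    G.Adj (f (i + 1)).1 (f i).1 := by
  have hs := hf.step i hi
  generalize f i = s at *
  generalize f (i + 1) = t at *
  cases hs with
  | child _ _ hadj => simp at h
  | parent _ hadj => exact hadj
  | collide _ hadj => exact hadj

lemma exists_descentTo (hf : IsCheapestTrail G D Z k f)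
    {i : ℕ} (hc : IsColliderAt k f i) : ∃ n, DescentTo G Z (f i).1 n := by
  have hs := hf.step i hc.1
  obtain ⟨-, h1, h2⟩ := hc
  generalize f i = s at *
  generalize f (i + 1) = t at *
  cases hs with
  | child _ _ hadj => simp at h2
  | parent _ hadj => simp at h1
  | collide hv hadj => exact exists_descentTo_iff.2 hv

lemma cost_of_collider (hf : IsCheapestTrail G D Z k f) {i : ℕ} (hc : IsColliderAt k f i) :
    costToGo G D Z (f i) = costToGo G D Z (f (i + 1)) + (descentDist G Z (f i).1 + 1) := by
  rw [hf.cost i hc.1, stepCost, if_pos hc.2]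

/-- A trail that turns from downwards to upwards pays for the distance to `Z`. -/
lemma descentDist_lt (hf : IsCheapestTrail G D Z k f)
    {i j : ℕ} (hij : i < j) (hj : j ≤ k) (hi : (f i).2 = false)
    (hu : (f j).2 = true) :
    (∃ n, DescentTo G Z (f i).1 n) ∧
      descentDist G Z (f i).1 + 1 + costToGo G D Z (f j) ≤ costToGo G D Z (f i) := by
  obtain ⟨m, rfl⟩ : ∃ m, j = i + 1 + m := ⟨j - (i + 1), by omega⟩
  induction m generalizing i with
  | zero =>
    have hc : IsColliderAt k f i := ⟨by omega, hi, hu⟩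
    have := hf.cost_of_collider hc
    exact ⟨hf.exists_descentTo hc, by simp only [Nat.add_zero]; omega⟩
  | succ m ih =>
    cases hd : (f (i + 1)).2 with
    | true =>
      have hc : IsColliderAt k f i := ⟨by omega, hi, hd⟩
      have h1 := hf.cost_of_collider hc
      have h2 := hf.costToGo_le (i := i + 1) (j := i + 1 + (m + 1)) (by omega) hj
      exact ⟨hf.exists_descentTo hc, by omega⟩
    -- Moving down one arc increases the cost to go by at least as much as it can increase the
    -- distance to `Z`, when read backwards.
    | false =>
      have e : i + 1 + (m + 1) = i + 1 + 1 + m := by omega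
      rw [e] at hj hu ⊢
      obtain ⟨h1, h2⟩ := ih (i := i + 1) hd (by omega) hj hu
      have hadj := hf.adj_of_down (by omega) hd
      have h3 := descentDist_le_succ hadj h1
      have h4 := hf.costToGo_lt (i := i) (j := i + 1) (by omega) (by omega)
      refine ⟨?_, by omega⟩
      obtain ⟨n, hn⟩ := h1
      exact ⟨n + 1, .succ hadj hn⟩

/-- A repeated vertex would allow the loop to be cut out. If the directions differ, `down` or `up`
bounds the price of the change, and a loop from `false` to `true` has already paid more than that by
`descentDist_lt`. -/
lemma vertex_ne (hf : IsCheapestTrail G D Z k f)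
    {i j : ℕ} (hij : i < j) (hj : j ≤ k) : (f i).1 ≠ (f j).1 := by
  intro h
  have hlt := hf.costToGo_lt hij hj
  have hci := hf.completable i (by omega)
  have hcj := hf.completable j hj
  cases hi : (f i).2 <;> cases hj' : (f j).2
  · have : f i = f j := Prod.ext h (hi.trans hj'.symm)
    rw [this] at hlt
    exact hlt.false
  · obtain ⟨h1, h2⟩ := hf.descentDist_lt hij hj hi hj'
    have ej : f j = ((f i).1, true) := Prod.ext h.symm hj'
    have ei : f i = ((f i).1, false) := Prod.ext rfl hi
    rw [ej] at hcj
    have h3 := (hcj.down h1).2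
    rw [← ej, ← ei] at h3
    omega
  · have hnZ := hf.notMem (i := i) (by omega) (fun hc => by simp [hc.2.1] at hi)
    have ej : f j = ((f i).1, false) := Prod.ext h.symm hj'
    have ei : f i = ((f i).1, true) := Prod.ext rfl hi
    rw [ej] at hcj
    have h3 := (hcj.up hnZ).2
    rw [← ej, ← ei] at h3
    omega
  · have : f i = f j := Prod.ext h (hi.trans hj'.symm)
    rw [this] at hlt
    exact hlt.false

lemma vertex_inj (hf : IsCheapestTrail G D Z k f)
    {i j : ℕ} (hi : i ≤ k) (hj : j ≤ k) (h : (f i).1 = (f j).1) : i = j := by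
  rcases lt_trichotomy i j with h' | h' | h'
  · exact absurd h (hf.vertex_ne h' hj)
  · exact h'
  · exact absurd h.symm (hf.vertex_ne h' hi)

/-- The shortest descents from the v-structures avoid the other vertices of the trail. -/
lemma descent_ne (hf : IsCheapestTrail G D Z k f)
    {i j : ℕ} (hc : IsColliderAt k f i) (hj : j ≤ k) (hnc : ¬ IsColliderAt k f j)
    (h : Relation.ReflTransGen (ShortestDescent G Z) (f i).1 (f j).1) : False := by
  have hjZ := hf.notMem hj hnc
  have hcost := hf.cost_of_collider hc
  have hdesc := exists_descentTo_of_reflTransGen (hf.exists_descentTo hc) h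
  have hcj := hf.completable j hj
  rcases lt_trichotomy i j with hij | rfl | hij
  -- If `i < j`: descending directly from `f i` to `f j`, and turning there if need be, costs at
  -- most the distance from `f i` to `Z`, less than the charge at `f i`.
  · have h1 : Completable G D Z ((f j).1, false) ∧
        costToGo G D Z ((f j).1, false) ≤ descentDist G Z (f j).1 + costToGo G D Z (f j) := by
      cases hd : (f j).2 with
      | false =>
        have e : f j = ((f j).1, false) := Prod.ext rfl hd
        rw [← e]
        exact ⟨hcj, by omega⟩
      | true =>
        have e : f j = ((f j).1, true) := Prod.ext rfl hd
        rw [e] at hcj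
        have := hcj.down hdesc
        rwa [← e] at this
    have h2 := (Completable.of_descent h h1.1).2
    have e : f i = ((f i).1, false) := Prod.ext rfl hc.2.1
    rw [← e] at h2
    have h3 := hf.costToGo_le (i := i + 1) (j := j) hij hj
    omega
  · exact hnc hc
  -- If `j < i`: climbing the descent from `f j` to `f i` and on to `f (i + 1)` completes the trail
  -- from `f j` at a cost of at most `costToGo G D Z (f i)`, which is too cheap.
  · have hiZ : (f i).1 ∉ Z := by
      rcases Relation.ReflTransGen.cases_head h with h | ⟨w, hw, -⟩
      · rwa [h]
      · exact hw.notMem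
    have e1 : f (i + 1) = ((f (i + 1)).1, true) := Prod.ext rfl hc.2.2
    have hup := (hf.completable (i + 1) hc.1)
    have hadj := hf.adj_of_up hc.1 hc.2.2
    rw [e1] at hup
    have h1 := hup.step (s := ((f i).1, true)) (.parent hiZ hadj)
    rw [← e1] at h1
    simp only [stepCost] at h1
    simp at h1
    have h2 := Completable.of_ascent hjZ h h1.1
    have h3 : costToGo G D Z (f j) ≤
        descentDist G Z (f j).1 + costToGo G D Z ((f j).1, true) := by
      cases hd : (f j).2 with
      | false =>
        have e : f j = ((f j).1, false) := Prod.ext rfl hd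
        have := (h2.1.down hdesc).2
        rwa [← e] at this
      | true =>
        have e : f j = ((f j).1, true) := Prod.ext rfl hd
        rw [← e]
        omega
    have h4 := hf.costToGo_lt hij hc.1.le
    omega

end IsCheapestTrail

end CheapestTrail

/-! ### Completeness of d-separation -/

section Completeness

variable {V : Type*} {G : Digraph V} {D Z : Set V}

lemma exists_isCheapestTrail_of_not_dSeparates (hG : IsAcyclicDigraph G) {B : Set V}
    (h : ¬ DSeparates G B D Z) :
    ∃ k f, (f 0).1 ∈ B ∧ (f 0).2 = true ∧ IsCheapestTrail G D Z k f := by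
  rw [dSeparates_iff_trailReach hG] at h
  push Not at h
  obtain ⟨d, hd, hdZ, dir, b, hb, hr⟩ := h
  have hc : Completable G D Z (b, true) := by
    generalize (b, true) = s at hr
    induction hr using Relation.ReflTransGen.head_induction_on with
    | refl => exact (completable_of_mem (s := (d, dir)) hd hdZ).1
    | head hst _ ih => exact (ih.step hst).1
  obtain ⟨k, f, h0, hf⟩ := hc.exists_isCheapestTrail
  exact ⟨k, f, by rwa [h0], by rw [h0], hf⟩

/-- The vertices of a trail that are not v-structures. -/
def connectors (k : ℕ) (f : ℕ → V × Bool) : Set V :=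
  {v | ∃ j ≤ k, ¬ IsColliderAt k f j ∧ (f j).1 = v}

/-- The vertices on shortest descents from the v-structures of a trail to `Z`. -/
def witnesses (G : Digraph V) (Z : Set V) (k : ℕ) (f : ℕ → V × Bool) : Set V :=
  {v | ∃ i, IsColliderAt k f i ∧ Relation.ReflTransGen (ShortestDescent G Z) (f i).1 v}

/-- The arcs of a trail. -/
def TrailArc (k : ℕ) (f : ℕ → V × Bool) (u v : V) : Prop :=
  ∃ i < k, ((f (i + 1)).2 = false ∧ (f i).1 = u ∧ (f (i + 1)).1 = v) ∨
    ((f (i + 1)).2 = true ∧ (f (i + 1)).1 = u ∧ (f i).1 = v)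

namespace IsCheapestTrail

variable {k : ℕ} {f : ℕ → V × Bool}

lemma connectors_notMem (hf : IsCheapestTrail G D Z k f) {v : V} (hv : v ∈ connectors k f) :
    v ∉ Z := by
  obtain ⟨j, hj, hnc, rfl⟩ := hv
  exact hf.notMem hj hnc

lemma connectors_notMem_witnesses (hf : IsCheapestTrail G D Z k f) {v : V}
    (hv : v ∈ connectors k f) : v ∉ witnesses G Z k f := by
  obtain ⟨j, hj, hnc, rfl⟩ := hv
  rintro ⟨i, hc, h⟩
  exact hf.descent_ne hc hj hnc h

lemma trailArc_adj (hf : IsCheapestTrail G D Z k f) {u v : V} (h : TrailArc k f u v) :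
    G.Adj u v := by
  obtain ⟨i, hi, ⟨hd, rfl, rfl⟩ | ⟨hd, rfl, rfl⟩⟩ := h
  · exact hf.adj_of_down hi hd
  · exact hf.adj_of_up hi hd

/-- Two arcs of the trail into one vertex would make it a v-structure, as no vertex is repeated. A
connector thus has at most one bit to copy. -/
lemma trailArc_unique (hf : IsCheapestTrail G D Z k f) {u u' v : V} (hv : v ∈ connectors k f)
    (h : TrailArc k f u v) (h' : TrailArc k f u' v) : u = u' := by
  obtain ⟨j, hj, hnc, rfl⟩ := hv
  obtain ⟨i, hi, ⟨hd, rfl, e⟩ | ⟨hd, rfl, e⟩⟩ := h <;>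
  obtain ⟨i', hi', ⟨hd', rfl, e'⟩ | ⟨hd', rfl, e'⟩⟩ := h'
  · have h1 := hf.vertex_inj hi hj e
    have h2 := hf.vertex_inj hi' hj e'
    have : i = i' := by omega
    rw [this]
  · have h1 := hf.vertex_inj hi hj e
    have h2 := hf.vertex_inj hi'.le hj e'
    subst h2
    rw [show i + 1 = i' from h1] at hd
    exact absurd ⟨hi', hd, hd'⟩ hnc
  · have h1 := hf.vertex_inj hi.le hj e
    have h2 := hf.vertex_inj hi' hj e'
    subst h1
    rw [show i' + 1 = i from h2] at hd'
    exact absurd ⟨hi, hd', hd⟩ hnc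
  · have h1 := hf.vertex_inj hi.le hj e
    have h2 := hf.vertex_inj hi'.le hj e'
    have : i = i' := by omega
    rw [this]

end IsCheapestTrail

lemma TrailArc.mem_connectors {k : ℕ} {f : ℕ → V × Bool} {u v : V} (h : TrailArc k f u v) :
    u ∈ connectors k f := by
  obtain ⟨i, hi, ⟨hd, rfl, -⟩ | ⟨hd, rfl, -⟩⟩ := h
  · exact ⟨i, hi.le, fun hc => by simp [hc.2.2] at hd, rfl⟩
  · exact ⟨i + 1, hi, fun hc => by simp [hc.2.1] at hd, rfl⟩

variable {𝒳 : V → Type*}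

/-- Some parent of `v` among the descents from v-structures signals, or `v` is a v-structure whose
neighbours on the trail disagree. -/
def Signals (G : Digraph V) (Z : Set V) (k : ℕ) (f : ℕ → V × Bool) (e x : ∀ v, 𝒳 v) (v : V) :
    Prop :=
  (∃ u ∈ witnesses G Z k f, G.Adj u v ∧ x u = e u) ∨
    ∃ i, IsColliderAt k f (i + 1) ∧ (f (i + 1)).1 = v ∧
      ¬ (x (f i).1 = e (f i).1 ↔ x (f (i + 2)).1 = e (f (i + 2)).1)

open Classical in
/-- The admissible values in a model in which the bit `x v = e v` is passed on along the trail,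
and the descents from v-structures signal a disagreement of bits to `Z`. -/
noncomputable def trailModel (G : Digraph V) (Z : Set V) (k : ℕ) (f : ℕ → V × Bool)
    (o e : ∀ v, 𝒳 v) (v : V) (x : ∀ v, 𝒳 v) : Set (𝒳 v) :=
  if v ∈ connectors k f then {a | ∀ u, TrailArc k f u v → (a = e v ↔ x u = e u)}
  else if v ∈ witnesses G Z k f then {if Signals G Z k f e x v then e v else o v}
  else {o v}

variable {k : ℕ} {f : ℕ → V × Bool} {o e : ∀ v, 𝒳 v}

lemma dependsOnlyOn_trailModel (hf : IsCheapestTrail G D Z k f) (v : V) :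
    DependsOnlyOn (trailModel G Z k f o e v) (parentSet G v) := by
  intro x y hxy
  have h1 : ∀ u, TrailArc k f u v → x u = y u := fun u hu => hxy u (hf.trailArc_adj hu)
  have h2 : Signals G Z k f e x v ↔ Signals G Z k f e y v := by
    unfold Signals
    refine or_congr ?_ ?_
    · refine exists_congr fun u => and_congr_right fun _ => and_congr_right fun hu => ?_
      rw [hxy u hu]
    · refine exists_congr fun i => and_congr_right fun hc => and_congr_right fun hv => ?_
      subst hv
      rw [hxy (f i).1 (hf.adj_of_down (by have := hc.1; omega) hc.2.1),
        hxy (f (i + 2)).1 (hf.adj_of_up hc.1 hc.2.2)]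
  unfold trailModel
  split_ifs
  · ext a
    exact forall₂_congr fun u hu => by rw [h1 u hu]
  all_goals simp_all

lemma trailModel_nonempty (hf : IsCheapestTrail G D Z k f) (hoe : ∀ v, o v ≠ e v) (v : V)
    (x : ∀ v, 𝒳 v) : (trailModel G Z k f o e v x).Nonempty := by
  classical
  unfold trailModel
  split_ifs with hv
  · by_cases h : ∃ u, TrailArc k f u v
    · obtain ⟨u, hu⟩ := h
      refine ⟨if x u = e u then e v else o v, fun u' hu' => ?_⟩
      obtain rfl := hf.trailArc_unique hv hu hu'
      by_cases hx : x u = e u <;> simp [hx, hoe]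
    · exact ⟨o v, fun u hu => absurd ⟨u, hu⟩ h⟩
  all_goals exact Set.singleton_nonempty _

/-- In the model of a trail, the values at its ends agree if nothing is signalled to `Z`. -/
lemma trailModel_bit_eq (hf : IsCheapestTrail G D Z k f) (h0 : (f 0).2 = true)
    (hoe : ∀ v, o v ≠ e v) {x : ∀ v, 𝒳 v} (hx : ∀ v, x v ∈ trailModel G Z k f o e v x)
    (hZ : ∀ v ∈ Z, x v = o v) : x (f 0).1 = e (f 0).1 ↔ x (f k).1 = e (f k).1 := by
  classical
  have hsig : ∀ v ∈ witnesses G Z k f, Signals G Z k f e x v → x v = e v := by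
    intro v hv hs
    have h1 := hx v
    have h2 : v ∉ connectors k f := fun h => hf.connectors_notMem_witnesses h hv
    simpa [trailModel, h2, hv, hs] using h1
  -- A signal at a witness is passed on down its shortest descent and would show up in `Z`.
  have hquiet : ∀ v ∈ witnesses G Z k f, x v ≠ e v := by
    rintro v ⟨i, hc, hiv⟩
    obtain ⟨z, hz, hvz⟩ := exists_reflTransGen_shortestDescent
      (exists_descentTo_of_reflTransGen (hf.exists_descentTo hc) hiv)
    induction hvz using Relation.ReflTransGen.head_induction_on with
    | refl => exact hZ z hz ▸ hoe z
    | @head a c hac _ ih =>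
      intro ha
      exact ih (hiv.tail hac) (hsig c ⟨i, hc, hiv.tail hac⟩ (Or.inl ⟨a, ⟨i, hc, hiv⟩, hac.1, ha⟩))
  have hcol : ∀ i, IsColliderAt k f (i + 1) →
      (x (f i).1 = e (f i).1 ↔ x (f (i + 2)).1 = e (f (i + 2)).1) := by
    intro i hc
    by_contra hcon
    have hw : (f (i + 1)).1 ∈ witnesses G Z k f := ⟨i + 1, hc, .refl⟩
    exact hquiet _ hw (hsig _ hw (Or.inr ⟨i, hc, rfl, hcon⟩))
  have harc : ∀ u v, v ∈ connectors k f → TrailArc k f u v → (x v = e v ↔ x u = e u) := by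
    intro u v hv huv
    have h1 := hx v
    rw [trailModel, if_pos hv] at h1
    exact h1 u huv
  -- The bit is carried along connectors; a v-structure is jumped over by `hcol`, its two neighbours
  -- on the trail being connectors. This jump of two is why the induction is strong.
  have key : ∀ i ≤ k, ¬ IsColliderAt k f i →
      (x (f 0).1 = e (f 0).1 ↔ x (f i).1 = e (f i).1) := by
    intro i
    induction i using Nat.strong_induction_on with
    | _ i ih =>
      intro hi hnc
      rcases i with _ | j
      · rfl
      by_cases hj : IsColliderAt k f j
      · rcases j with _ | m
        · simp [hj.2.1] at h0
        · have hm : ¬ IsColliderAt k f m := fun hc => by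
            have := hj.2.1
            simp [hc.2.2] at this
          exact (ih m (by omega) (by omega) hm).trans (hcol m hj)
      · refine (ih j (by omega) (by omega) hj).trans ?_
        cases hd : (f (j + 1)).2 with
        | false => exact (harc _ _ ⟨j + 1, hi, hnc, rfl⟩ ⟨j, hi, Or.inl ⟨hd, rfl, rfl⟩⟩).symm
        | true => exact harc _ _ ⟨j, by omega, hj, rfl⟩ ⟨j, hi, Or.inr ⟨hd, rfl, rfl⟩⟩
  exact key k le_rfl fun hc => hc.1.false

lemma mem_trailModel_zero (hoe : ∀ v, o v ≠ e v) (v : V) : o v ∈ trailModel G Z k f o e v o := by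
  have h : ¬ Signals G Z k f e o v := by simp [Signals, hoe]
  unfold trailModel
  split_ifs
  · exact fun u _ => by simp [hoe]
  all_goals rfl

-- The second configuration of the counterexample: all connectors carry the bit. Witnesses stay
-- silent, since they are not connectors and both neighbours of each v-structure are.
open Classical in
lemma mem_trailModel_one (hf : IsCheapestTrail G D Z k f) (hoe : ∀ v, o v ≠ e v) (v : V) :
    (if v ∈ connectors k f then e v else o v) ∈
      trailModel G Z k f o e v (fun v => if v ∈ connectors k f then e v else o v) := by
  by_cases hv : v ∈ connectors k f
  · rw [trailModel, if_pos hv, if_pos hv]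
    exact fun u hu => by simp [hu.mem_connectors]
  · rw [trailModel, if_neg hv, if_neg hv]
    split_ifs with hw hs
    · exfalso
      rcases hs with ⟨u, hu, -, h⟩ | ⟨i, hc, -, h⟩
      · have : u ∉ connectors k f := fun h => hf.connectors_notMem_witnesses h hu
        exact hoe u (by simpa [this] using h)
      · have h1 : (f i).1 ∈ connectors k f :=
          ⟨i, by have := hc.1; omega, fun hc' => by have := hc.2.1; simp [hc'.2.2] at this, rfl⟩
        have h2 : (f (i + 2)).1 ∈ connectors k f :=
          ⟨i + 2, hc.1, fun hc' => by have := hc.2.2; simp [hc'.2.1] at this, rfl⟩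
        exact h (by simp [h1, h2])
    all_goals rfl

variable [Fintype V] [∀ v, Fintype (𝒳 v)] [∀ v, MeasurableSpace (𝒳 v)]
  [∀ v, DiscreteMeasurableSpace (𝒳 v)] [∀ v, Nontrivial (𝒳 v)]

/-- Completeness of d-separation for directed graphical models. -/
lemma exists_not_condIndepSubvectors_of_not_dSeparates (hG : IsAcyclicDigraph G) {B : Set V}
    (h : ¬ DSeparates G B D Z) :
    ∃ (μ : Measure (∀ v, 𝒳 v)) (_ : IsProbabilityMeasure μ),
      FactorizesDirected G μ ∧ ¬ CondIndepSubvectors μ B D Z := by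
  classical
  obtain ⟨k, f, hB, h0, hf⟩ := exists_isCheapestTrail_of_not_dSeparates hG h
  choose o e hoe using fun v => exists_pair_ne (𝒳 v)
  obtain ⟨μ, hμ, hfac, hsupp⟩ := exists_factorizesDirected_of_support hG
    (trailModel G Z k f o e) (dependsOnlyOn_trailModel hf) (trailModel_nonempty hf hoe)
  have hpos : ∀ x : ∀ v, 𝒳 v, (∀ v, x v ∈ trailModel G Z k f o e v x) → 0 < μ.real {x} :=
    fun x hx => lt_of_le_of_ne measureReal_nonneg ((hsupp x).2 hx).symm
  refine ⟨μ, hμ, hfac, not_condIndepSubvectors μ hB hf.last_mem (a := e _) (c := e _) (x₀ := o)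
    (hpos _ (mem_trailModel_zero hoe)) (hpos _ (mem_trailModel_one hf hoe)) ?_ (hoe _) ?_ ?_⟩
  · intro v hv
    exact if_neg fun h => hf.connectors_notMem h hv
  · exact if_pos ⟨0, Nat.zero_le _, fun hc => by simp [hc.2.1] at h0, rfl⟩
  · intro x hxZ hx
    exact trailModel_bit_eq hf h0 hoe ((hsupp x).1 hx) hxZ

lemma indepDirected_iff_dSeparates (hG : IsAcyclicDigraph G) (B D Z : Set V) :
    IndepDirected 𝒳 G B D Z ↔ DSeparates G B D Z := by
  constructor
  · intro h
    by_contra hcon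
    obtain ⟨μ, hμ, hfac, hdep⟩ :=
      exists_not_condIndepSubvectors_of_not_dSeparates (𝒳 := 𝒳) hG hcon
    exact hdep (h μ hfac)
  · intro h μ _ hμ
    exact condIndepSubvectors_of_dSeparates hG h μ hμ

end Completeness

theorem mainTheorem1 {V : Type*} [Fintype V] (𝒳 : V → Type*) [∀ v, Fintype (𝒳 v)]
    [∀ v, Nontrivial (𝒳 v)] [∀ v, MeasurableSpace (𝒳 v)]
    [∀ v, DiscreteMeasurableSpace (𝒳 v)] (B C E : Set V) :
    (∀ G : SimpleGraph V,
      (∃! M : Set V, IsMarkovBlanketIn (IndepUndirected 𝒳 G) B C E M) ∧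
      IsMarkovBlanketIn (IndepUndirected 𝒳 G) B C E
        {v ∈ C \ B | ¬ Separates G B {v} (E ∪ (C \ (B ∪ {v})))}) ∧
    (∀ G : Digraph V, IsAcyclicDigraph G →
      (∃! M : Set V, IsMarkovBlanketIn (IndepDirected 𝒳 G) B C E M) ∧
      IsMarkovBlanketIn (IndepDirected 𝒳 G) B C E
        {v ∈ C \ B | ¬ DSeparates G B {v} (E ∪ (C \ (B ∪ {v})))}) := by
  refine ⟨fun G => ?_, fun G hG => ?_⟩
  · have h := isMarkovBlanketIn_of_separation (indepUndirected_iff_separates (𝒳 := 𝒳) G)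
      (separates_iff_forall_singleton G) B C E
    exact ⟨h.existsUnique, h⟩
  · have h := isMarkovBlanketIn_of_separation (indepDirected_iff_dSeparates (𝒳 := 𝒳) hG)
      (dSeparates_iff_forall_singleton hG) B C E
    exact ⟨h.existsUnique, h⟩
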